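/- Let $M$ be a smooth manifold with an almost Norden structure $(J,g)$: $J$ is a smooth almost complex structure and $g$ a smooth pseudo-Riemannian metric with $g(JX,JY)=-g(X,Y)$ (so $g$ has neutral signature). Let $\nabla$ be the Levi-Civita connection of $g$, and let $X^H$, $X^V$ denote the horizontal lift (with respect to $\nabla$) and the vertical lift of $X$ to the tangent bundle $TM$. Equip $TM$ with the almost complex structures $$J_1:\ X^H\mapsto-(JX)^H,\ X^V\mapsto(JX)^V;\qquad J_2:\ X^H\mapsto X^V,\ X^V\mapsto-X^H;\qquad J_3:\ X^H\mapsto(JX)^V,\ X^V\mapsto(JX)^H,$$ and with the complete lift $\hat g$ of $g$, that is $$\hat g(X^H,Y^H)=\hat g(X^V,Y^V)=0,\qquad \hat g(X^H,Y^V)=\hat g(X^V,Y^H)=g(X,Y).$$ For a pseudo-Riemannian metric $h$ with Levi-Civita connection $D$ and an almost complex structure $K$ put $F(x,y,z)=h((D_xK)y,z)$, and let the Lee form be $\theta(z)=h^{ij}F(e_i,e_j,z)$, for any basis $(e_i)$ of the tangent space. The pair $(K,h)$ is almost Hermitian if $h(Kx,Ky)=h(x,y)$ and almost Norden if $h(Kx,Ky)=-h(x,y)$.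 An almost Hermitian pair is semi-Kähler ($\mathcal{SK}$) if $\theta=0$, and almost Kähler ($\mathcal{AK}$) if the 2-form $h(K\cdot,\cdot)$ is closed. An almost Norden pair is Kähler–Norden ($\mathcal W_0$) if $DK=0$, and lies in $\mathcal W_2\oplus\mathcal W_3$ if $\theta=0$. Then: (i) If $g$ is flat, then $J_2$ is parallel with respect to the Levi-Civita connection of $\hat g$. (ii) If $g$ is flat and the Lee form of $(J,g)$ vanishes, i.e. $(M,J,g)\in\mathcal W_2\oplus\mathcal W_3$, then $(TM,J_1,\hat g)\in\mathcal{SK}$, $(TM,J_2,\hat g)\in\mathcal W_0$ and $(TM,J_3,\hat g)\in\mathcal W_2\oplus\mathcal W_3$. (iii) If $(M,J,g)$ is Kähler–Norden, then $(TM,J_1,\hat g)\in\mathcal{AK}$. -/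

import Mathlib

open Bundle Manifold VectorField FiberBundle
open scoped ContDiff Topology

noncomputable section

section General

variable {E : Type*} [NormedAddCommGroup E] [NormedSpace ℝ E]
  {H : Type*} [TopologicalSpace H] (I : ModelWithCorners ℝ E H)
  (M : Type*) [TopologicalSpace M] [ChartedSpace H M]

/-- A field of bilinear forms on the tangent spaces: a (0,2)-tensor field, no smoothness required. -/
abbrev BilinField : Type _ := ∀ x : M, TangentSpace I x →L[ℝ] TangentSpace I x →L[ℝ] ℝ

/-- A field of endomorphisms of the tangent spaces: a (1,1)-tensor field, no smoothness required. -/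
abbrev EndoField : Type _ := ∀ x : M, TangentSpace I x →L[ℝ] TangentSpace I x

/-- The type of operators `Y ↦ (x ↦ (v ↦ (∇_v Y)(x)))`, with Mathlib's order of arguments: `cov Y x v`
is `∇_v Y` at `x`. -/
abbrev Connection : Type _ :=
  (Π x : M, TangentSpace I x) → (Π x : M, TangentSpace I x →L[ℝ] TangentSpace I x)

variable {I M}

/-- The (0,2)-tensor field `g` is a `C^∞` section of the bundle of bilinear forms. -/
def BilinField.IsSmooth [IsManifold I ∞ M] (g : BilinField I M) : Prop :=
  ContMDiff I (I.prod 𝓘(ℝ, E →L[ℝ] E →L[ℝ] ℝ)) ∞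
    (fun x ↦ TotalSpace.mk' (E →L[ℝ] E →L[ℝ] ℝ)
      (E := fun x : M ↦ TangentSpace I x →L[ℝ] TangentSpace I x →L[ℝ] ℝ) x (g x))

/-- The (1,1)-tensor field `J` is a `C^∞` section of the endomorphism bundle. -/
def EndoField.IsSmooth [IsManifold I ∞ M] (J : EndoField I M) : Prop :=
  ContMDiff I (I.prod 𝓘(ℝ, E →L[ℝ] E)) ∞
    (fun x ↦ TotalSpace.mk' (E →L[ℝ] E)
      (E := fun x : M ↦ TangentSpace I x →L[ℝ] TangentSpace I x) x (J x))

/-- `g` is a pseudo-Riemannian metric. -/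
structure IsMetric [IsManifold I ∞ M] (g : BilinField I M) : Prop where
  smooth : g.IsSmooth
  symm : ∀ (x : M) (v w : TangentSpace I x), g x v w = g x w v
  nondegenerate : ∀ (x : M) (v : TangentSpace I x), (∀ w, g x v w = 0) → v = 0

/-- `cov` is a torsion-free covariant derivative compatible with `g`. -/
structure IsLeviCivita [IsManifold I ∞ M] (g : BilinField I M) (cov : Connection I M) : Prop where
  isCovariantDerivative : IsCovariantDerivativeOn E cov
  torsionFree : ∀ {X Y : Π x : M, TangentSpace I x} {x : M},
    MDiffAt (T% X) x → MDiffAt (T% Y) x →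
      cov Y x (X x) - cov X x (Y x) = mlieBracket I X Y x
  metric : ∀ {Y Z : Π x : M, TangentSpace I x} {x : M},
    MDiffAt (T% Y) x → MDiffAt (T% Z) x → ∀ v : TangentSpace I x,
      d% (fun y ↦ g y (Y y) (Z y)) x v = g x (cov Y x v) (Z x) + g x (Y x) (cov Z x v)

/-- The right-hand side of the Koszul formula for `2 g(∇_X Y, Z)`. -/
def koszul (g : BilinField I M) (X Y Z : Π x : M, TangentSpace I x) (x : M) : ℝ :=
  d% (fun y ↦ g y (Y y) (Z y)) x (X x) + d% (fun y ↦ g y (X y) (Z y)) x (Y x)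
    - d% (fun y ↦ g y (X y) (Y y)) x (Z x)
    + g x (mlieBracket I X Y x) (Z x) - g x (mlieBracket I X Z x) (Y x)
    - g x (mlieBracket I Y Z x) (X x)

variable [IsManifold I ∞ M]

theorem BilinField.IsSmooth.mdiffAt {g : BilinField I M} (hg : g.IsSmooth)
    {Y Z : Π x : M, TangentSpace I x} {x : M}
    (hY : MDiffAt (T% Y) x) (hZ : MDiffAt (T% Z) x) :
    MDiffAt (fun y ↦ g y (Y y) (Z y)) x := by
  have h : MDiffAt (fun m ↦ TotalSpace.mk' (E →L[ℝ] E →L[ℝ] ℝ)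
      (E := fun x : M ↦ TangentSpace I x →L[ℝ] TangentSpace I x →L[ℝ] ℝ) m (g m)) x :=
    (hg x).mdifferentiableAt (by simp)
  have := MDifferentiableAt.clm_bundle_apply₂ (b := fun x : M ↦ x) (F₃ := ℝ)
     (E₃ := Bundle.Trivial M ℝ) h hY hZ
  simp only [mdifferentiableAt_totalSpace] at this
  exact this.2

theorem IsMetric.ext {g : BilinField I M} (hg : IsMetric g) {x : M} {v w : TangentSpace I x}
    (h : ∀ z, g x v z = g x w z) : v = w := by
  refine sub_eq_zero.1 (hg.nondegenerate x _ fun z ↦ ?_)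
  simp [h z]

variable [FiniteDimensional ℝ E]

theorem koszul_tensorial_left {g : BilinField I M} (hg : IsMetric g)
    {Y Z : Π x : M, TangentSpace I x} {x : M}
    (hY : MDiffAt (T% Y) x) (hZ : MDiffAt (T% Z) x) :
    TensorialAt I E (fun X ↦ koszul g X Y Z x) x where
  smul {f X} hf hX := by
    have := FiniteDimensional.complete ℝ E
    have e1 : (fun y ↦ g y ((f • X) y) (Z y)) = f * (fun y ↦ g y (X y) (Z y)) := by
      ext y; simp
    have e2 : (fun y ↦ g y ((f • X) y) (Y y)) = f * (fun y ↦ g y (X y) (Y y)) := by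
      ext y; simp
    simp only [koszul]
    rw [e1, e2, mvfderiv_mul hf (hg.smooth.mdiffAt hX hZ), mvfderiv_mul hf (hg.smooth.mdiffAt hX hY),
      mlieBracket_smul_left hf hX, mlieBracket_smul_left hf hX]
    simp
    ring
  add {X X'} hX hX' := by
    have := FiniteDimensional.complete ℝ E
    have e1 : (fun y ↦ g y ((X + X') y) (Z y)) =
      (fun y ↦ g y (X y) (Z y)) + (fun y ↦ g y (X' y) (Z y)) := by
      ext y; simp
    have e2 : (fun y ↦ g y ((X + X') y) (Y y)) =
      (fun y ↦ g y (X y) (Y y)) + (fun y ↦ g y (X' y) (Y y)) := by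
      ext y; simp
    simp only [koszul]
    rw [e1, e2, mvfderiv_add (hg.smooth.mdiffAt hX hZ) (hg.smooth.mdiffAt hX' hZ),
      mvfderiv_add (hg.smooth.mdiffAt hX hY) (hg.smooth.mdiffAt hX' hY),
      mlieBracket_add_left hX hX', mlieBracket_add_left hX hX']
    simp
    ring

theorem koszul_tensorial_right {g : BilinField I M} (hg : IsMetric g)
    {X Y : Π x : M, TangentSpace I x} {x : M}
    (hX : MDiffAt (T% X) x) (hY : MDiffAt (T% Y) x) :
    TensorialAt I E (fun Z ↦ koszul g X Y Z x) x where
  smul {f Z} hf hZ := by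
    have := FiniteDimensional.complete ℝ E
    have e1 : (fun y ↦ g y (Y y) ((f • Z) y)) = f * (fun y ↦ g y (Y y) (Z y)) := by
      ext y; simp
    have e2 : (fun y ↦ g y (X y) ((f • Z) y)) = f * (fun y ↦ g y (X y) (Z y)) := by
      ext y; simp
    simp only [koszul]
    rw [e1, e2, mvfderiv_mul hf (hg.smooth.mdiffAt hY hZ), mvfderiv_mul hf (hg.smooth.mdiffAt hX hZ),
      mlieBracket_smul_right hf hZ, mlieBracket_smul_right hf hZ]
    simp
    rw [hg.symm x (Z x) (Y x), hg.symm x (Z x) (X x)]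
    ring
  add {Z Z'} hZ hZ' := by
    have := FiniteDimensional.complete ℝ E
    have e1 : (fun y ↦ g y (Y y) ((Z + Z') y)) =
      (fun y ↦ g y (Y y) (Z y)) + (fun y ↦ g y (Y y) (Z' y)) := by
      ext y; simp
    have e2 : (fun y ↦ g y (X y) ((Z + Z') y)) =
      (fun y ↦ g y (X y) (Z y)) + (fun y ↦ g y (X y) (Z' y)) := by
      ext y; simp
    simp only [koszul]
    rw [e1, e2, mvfderiv_add (hg.smooth.mdiffAt hY hZ) (hg.smooth.mdiffAt hY hZ'),
      mvfderiv_add (hg.smooth.mdiffAt hX hZ) (hg.smooth.mdiffAt hX hZ'),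
      mlieBracket_add_right hZ hZ', mlieBracket_add_right hZ hZ']
    simp
    ring

theorem exists_sharp {F : Type*} [NormedAddCommGroup F] [NormedSpace ℝ F]
    [FiniteDimensional ℝ F] (f : F →L[ℝ] F →L[ℝ] ℝ) (hf : ∀ v, (∀ w, f v w = 0) → v = 0) :
    ∃ S : (F →L[ℝ] ℝ) →L[ℝ] F, ∀ φ z, f (S φ) z = φ z := by
  have hinj : Function.Injective (f : F →ₗ[ℝ] (F →L[ℝ] ℝ)) := by
    rw [injective_iff_map_eq_zero]
    intro v hv
    exact hf v fun w ↦ by simpa using congr($hv w)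
  have hfr : Module.finrank ℝ F = Module.finrank ℝ (F →L[ℝ] ℝ) := by
    rw [← (LinearMap.toContinuousLinearMap (𝕜 := ℝ) (E := F) (F' := ℝ)).finrank_eq]
    exact (Subspace.dual_finrank_eq (K := ℝ) (V := F)).symm
  let e := LinearEquiv.ofBijective (f : F →ₗ[ℝ] (F →L[ℝ] ℝ))
    ⟨hinj, (LinearMap.injective_iff_surjective_of_finrank_eq_finrank hfr).1 hinj⟩
  refine ⟨e.symm.toLinearMap.toContinuousLinearMap, fun φ z ↦ ?_⟩
  have : e (e.symm φ) = φ := e.apply_symm_apply φ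
  exact congr($this z)

theorem IsMetric.exists_connection {g : BilinField I M} (hg : IsMetric g) :
    ∃ cov : Connection I M, ∀ {X Y Z : Π x : M, TangentSpace I x} {x : M},
      MDiffAt (T% X) x → MDiffAt (T% Y) x → MDiffAt (T% Z) x →
        2 * g x (cov Y x (X x)) (Z x) = koszul g X Y Z x := by
  classical
  have hS : ∀ x : M, ∃ S : (TangentSpace I x →L[ℝ] ℝ) →L[ℝ] TangentSpace I x,
      ∀ φ z, g x (S φ) z = φ z := fun x ↦
    exists_sharp (F := E) (g x) (hg.nondegenerate x)
  choose S hS using hS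
  let cov : Connection I M := fun Y x ↦
    if hY : MDiffAt (T% Y) x then
      (1 / 2 : ℝ) • S x ∘L TensorialAt.mkHom₂ (I := I) (F := E) (F' := E) (V := TangentSpace I)
        (V' := TangentSpace I) (fun X Z ↦ koszul g X Y Z x) x
        (fun _ hZ ↦ koszul_tensorial_left hg hY hZ) (fun _ hX ↦ koszul_tensorial_right hg hX hY)
    else 0
  refine ⟨cov, fun {X Y Z x} hX hY hZ ↦ ?_⟩
  simp only [cov, dif_pos hY, smul_apply, ContinuousLinearMap.comp_apply,
    map_smul, hS, smul_eq_mul]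
  rw [TensorialAt.mkHom₂_apply _ _ hX hZ]
  ring

/-- The fundamental theorem of pseudo-Riemannian geometry. -/
theorem IsMetric.exists_isLeviCivita {g : BilinField I M} (hg : IsMetric g) :
    ∃ cov, IsLeviCivita g cov := by
  have := FiniteDimensional.complete ℝ E
  obtain ⟨cov, hcov⟩ := hg.exists_connection
  have key : ∀ {Y : Π x : M, TangentSpace I x} {x : M}, MDiffAt (T% Y) x →
      ∀ v z : TangentSpace I x,
        2 * g x (cov Y x v) z = koszul g (extend E v) Y (extend E z) x := by
    intro Y x hY v z
    simpa using hcov (mdifferentiableAt_extend I E v) hY (mdifferentiableAt_extend I E z)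
  refine ⟨cov, ⟨⟨?_, ?_⟩, ?_, ?_⟩⟩
  · intro Y Y' x hY hY' _
    ext v
    refine hg.ext fun z ↦ ?_
    have hv := mdifferentiableAt_extend I E v
    have hz := mdifferentiableAt_extend I E z
    have e1 : (fun y ↦ g y ((Y + Y') y) (extend E z y)) =
      (fun y ↦ g y (Y y) (extend E z y)) + (fun y ↦ g y (Y' y) (extend E z y)) := by
      ext y; simp
    have e2 : (fun y ↦ g y (extend E v y) ((Y + Y') y)) =
      (fun y ↦ g y (extend E v y) (Y y)) + (fun y ↦ g y (extend E v y) (Y' y)) := by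
      ext y; simp
    have h := key (mdifferentiableAt_add_section hY hY') v z
    have h1 := key hY v z
    have h2 := key hY' v z
    simp only [koszul] at h h1 h2
    rw [e1, e2, mvfderiv_add (hg.smooth.mdiffAt hY hz) (hg.smooth.mdiffAt hY' hz),
      mvfderiv_add (hg.smooth.mdiffAt hv hY) (hg.smooth.mdiffAt hv hY'),
      mlieBracket_add_left hY hY', mlieBracket_add_right hY hY'] at h
    simp at h h1 h2 ⊢
    linarith
  · intro Y f x hY hf _
    ext v
    refine hg.ext fun z ↦ ?_
    have hv := mdifferentiableAt_extend I E v
    have hz := mdifferentiableAt_extend I E z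
    have e1 : (fun y ↦ g y ((f • Y) y) (extend E z y)) =
      f * (fun y ↦ g y (Y y) (extend E z y)) := by
      ext y; simp
    have e2 : (fun y ↦ g y (extend E v y) ((f • Y) y)) =
      f * (fun y ↦ g y (extend E v y) (Y y)) := by
      ext y; simp
    have h := key (hf.smul_section hY) v z
    have h1 := key hY v z
    simp only [koszul] at h h1
    rw [e1, e2, mvfderiv_mul hf (hg.smooth.mdiffAt hY hz),
      mvfderiv_mul hf (hg.smooth.mdiffAt hv hY),
      mlieBracket_smul_left hf hY, mlieBracket_smul_right hf hY] at h
    simp at h h1 ⊢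
    rw [hg.symm x (Y x) v] at h
    linear_combination (1/2) * h - (f x / 2) * h1
  · intro X Y x hX hY
    refine hg.ext fun z ↦ ?_
    have hz := mdifferentiableAt_extend I E z
    have h1 := hcov hX hY hz
    have h2 := hcov hY hX hz
    have e : (fun y ↦ g y (X y) (Y y)) = (fun y ↦ g y (Y y) (X y)) := by
      ext y; exact hg.symm y _ _
    simp only [koszul] at h1 h2
    rw [e] at h1
    rw [mlieBracket_swap_apply (V := Y) (W := X)] at h2
    simp at h1 h2 ⊢
    linear_combination (1/2) * h1 - (1/2) * h2
  · intro Y Z x hY hZ v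
    have hv := mdifferentiableAt_extend I E v
    have h1 := hcov hv hY hZ
    have h2 := hcov hv hZ hY
    have e : (fun y ↦ g y (Z y) (Y y)) = (fun y ↦ g y (Y y) (Z y)) := by
      ext y; exact hg.symm y _ _
    simp only [koszul] at h1 h2
    rw [e, mlieBracket_swap_apply (V := Z) (W := Y)] at h2
    rw [hg.symm x (Y x)]
    simp at h1 h2 ⊢
    linear_combination (-1/2) * h1 - (1/2) * h2


/-- The Levi-Civita connection of `g`. It exists for every metric, by `IsMetric.exists_isLeviCivita`. -/
def leviCivita (g : BilinField I M) : Connection I M :=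
  Classical.epsilon (IsLeviCivita g)

theorem IsMetric.isLeviCivita_leviCivita {g : BilinField I M} (hg : IsMetric g) :
    IsLeviCivita g (leviCivita g) :=
  Classical.epsilon_spec hg.exists_isLeviCivita

/-- The curvature `R(v,w)z = ∇_V ∇_W Z - ∇_W ∇_V Z - ∇_[V,W] Z` at `x`, where `V`, `W`, `Z` are the
vector fields, smooth near `x`, that Mathlib's `extend` attaches to the vectors `v`, `w`, `z`. -/
def curvature (g : BilinField I M) (x : M) (v w z : TangentSpace I x) : TangentSpace I x :=
  leviCivita g (fun y ↦ leviCivita g (extend E z) y (extend E w y)) x v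
    - leviCivita g (fun y ↦ leviCivita g (extend E z) y (extend E v y)) x w
    - leviCivita g (extend E z) x (mlieBracket I (extend E v) (extend E w) x)

/-- The metric `g` is flat: the curvature of its Levi-Civita connection vanishes. -/
def IsFlat (g : BilinField I M) : Prop :=
  ∀ (x : M) (v w z : TangentSpace I x), curvature g x v w z = 0

/-- `(∇_v J) y = ∇_v (J Y) - J (∇_v Y)` at `x`, where `Y` is the extension of `y` to a vector field. -/
def covDerivEndo (g : BilinField I M) (J : EndoField I M) (x : M) (v y : TangentSpace I x) :
    TangentSpace I x :=
  leviCivita g (fun q ↦ J q (extend E y q)) x v - J x (leviCivita g (extend E y) x v)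

/-- `∇ J = 0` for the Levi-Civita connection `∇` of `g`. -/
def IsParallel (g : BilinField I M) (J : EndoField I M) : Prop :=
  ∀ (x : M) (v y : TangentSpace I x), covDerivEndo g J x v y = 0

/-- The structure tensor `F(v,y,z) = g((∇_v J) y, z)`. -/
def structureTensor (g : BilinField I M) (J : EndoField I M) (x : M)
    (v y z : TangentSpace I x) : ℝ :=
  g x (covDerivEndo g J x v y) z

/-- The Lee form `θ(z) = ∑ i j, g^{ij} F(e_i, e_j, z)`, where `(e_i)` is a basis of the tangent space
and `(g^{ij})` is the inverse of the Gram matrix `(g(e_i, e_j))`. The value does not depend on the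
basis. -/
def leeForm (g : BilinField I M) (J : EndoField I M) (x : M) (z : TangentSpace I x) : ℝ :=
  let e : Module.Basis (Fin (Module.finrank ℝ E)) ℝ (TangentSpace I x) := Module.finBasis ℝ E
  let G : Matrix (Fin (Module.finrank ℝ E)) (Fin (Module.finrank ℝ E)) ℝ :=
    Matrix.of fun i j ↦ g x (e i) (e j)
  ∑ i, ∑ j, G⁻¹ i j * structureTensor g J x (e i) (e j) z

/-- The (0,2)-tensor field `g(J ·, ·)`. -/
def twoForm (g : BilinField I M) (J : EndoField I M) : BilinField I M :=
  fun x ↦ (g x).comp (J x)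

/-- The exterior derivative of a 2-form: `dη(U,V,W) = U η(V,W) - V η(U,W) + W η(U,V)
- η([U,V],W) + η([U,W],V) - η([V,W],U)` at `x`. -/
def extDerivTwo (η : BilinField I M) (x : M) (u v w : TangentSpace I x) : ℝ :=
  let U : Π y : M, TangentSpace I y := extend E u
  let V : Π y : M, TangentSpace I y := extend E v
  let W : Π y : M, TangentSpace I y := extend E w
  d% (fun y ↦ η y (V y) (W y)) x u - d% (fun y ↦ η y (U y) (W y)) x v
    + d% (fun y ↦ η y (U y) (V y)) x w
    - η x (mlieBracket I U V x) w + η x (mlieBracket I U W x) v - η x (mlieBracket I V W x) u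

/-- `(g, J)` is an almost Hermitian structure: `J` is an almost complex structure that acts as an
isometry of the (pseudo-Riemannian) metric `g`. -/
structure IsAlmostHermitian (g : BilinField I M) (J : EndoField I M) : Prop where
  isMetric : IsMetric g
  smooth : J.IsSmooth
  sq : ∀ (x : M) (v : TangentSpace I x), J x (J x v) = -v
  isometry : ∀ (x : M) (v w : TangentSpace I x), g x (J x v) (J x w) = g x v w

/-- `(g, J)` is an almost Norden structure: `J` is an almost complex structure that acts as an
anti-isometry of the (pseudo-Riemannian) metric `g`. The signature is then neutral. -/
structure IsAlmostNorden (g : BilinField I M) (J : EndoField I M) : Prop where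
  isMetric : IsMetric g
  smooth : J.IsSmooth
  sq : ∀ (x : M) (v : TangentSpace I x), J x (J x v) = -v
  antiIsometry : ∀ (x : M) (v w : TangentSpace I x), g x (J x v) (J x w) = -g x v w

/-- The class `SK` of semi-Kaehler manifolds: almost Hermitian with vanishing Lee form. -/
def IsSemiKahler (g : BilinField I M) (J : EndoField I M) : Prop :=
  IsAlmostHermitian g J ∧ ∀ (x : M) (z : TangentSpace I x), leeForm g J x z = 0

/-- The class `AK` of almost Kaehler manifolds: almost Hermitian with closed Kaehler form. -/
def IsAlmostKahler (g : BilinField I M) (J : EndoField I M) : Prop :=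
  IsAlmostHermitian g J ∧
    ∀ (x : M) (u v w : TangentSpace I x), extDerivTwo (twoForm g J) x u v w = 0

/-- The class `W₀` of Kaehler-Norden manifolds: almost Norden with parallel `J`. -/
def IsKahlerNorden (g : BilinField I M) (J : EndoField I M) : Prop :=
  IsAlmostNorden g J ∧ IsParallel g J

/-- The class `W₂ ⊕ W₃` of almost Norden manifolds: those with vanishing Lee form. -/
def IsNordenW₂W₃ (g : BilinField I M) (J : EndoField I M) : Prop :=
  IsAlmostNorden g J ∧ ∀ (x : M) (z : TangentSpace I x), leeForm g J x z = 0

end General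

section Tangent

variable {E : Type*} [NormedAddCommGroup E] [NormedSpace ℝ E]
  {H : Type*} [TopologicalSpace H] {I : ModelWithCorners ℝ E H}
  {M : Type*} [TopologicalSpace M] [ChartedSpace H M] [IsManifold I ∞ M]

/-- The vertical lift of `w ∈ T_p M` to `u ∈ T_p M`: the velocity at `t = 0` of the curve `u + t w`
in the tangent bundle. -/
def verticalLift (u : TangentBundle I M) (w : TangentSpace I u.1) : TangentSpace I.tangent u :=
  let D : TangentSpace 𝓘(ℝ, ℝ) (0 : ℝ) →L[ℝ] TangentSpace I.tangent u :=
    mfderiv 𝓘(ℝ, ℝ) I.tangent (fun t : ℝ ↦ (⟨u.1, u.2 + t • w⟩ : TangentBundle I M)) 0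
  D (1 : ℝ)

/-- The horizontal lift of `v ∈ T_p M` to `u ∈ T_p M` for the connection `∇`: if `U` is a vector field
with `U(p) = u`, considered as a map from `M` to the tangent bundle, it is `dU(v) - (∇_v U)^V`.
Here `D` is the differential `dU`. -/
def horizontalLift (cov : Connection I M) (u : TangentBundle I M) (v : TangentSpace I u.1) :
    TangentSpace I.tangent u :=
  let D : TangentSpace I u.1 →L[ℝ] TangentSpace I.tangent u :=
    mfderiv I I.tangent (fun q : M ↦ (⟨q, extend E u.2 q⟩ : TangentBundle I M)) u.1
  D v - verticalLift u (cov (extend E u.2) u.1 v)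

theorem trivializationAt_snd (p : M) (w : TangentSpace I p) :
    (trivializationAt E (TangentSpace I) p (⟨p, w⟩ : TangentBundle I M)).2 = w := by
  rw [TangentBundle.trivializationAt_apply]
  exact tangentCoordChange_self (I := I) (x := p) (z := p) (v := w) (mem_extChartAt_source p)

theorem extChartAt_mk (u : TangentBundle I M) (p q : M) (w : TangentSpace I q) (hu : u.1 = p) :
    extChartAt I.tangent u (⟨q, w⟩ : TangentBundle I M) =
    (extChartAt I p q, (trivializationAt E (TangentSpace I) p (⟨q, w⟩ : TangentBundle I M)).2) := by
  subst hu
  rw [ModelWithCorners.tangent, FiberBundle.extChartAt]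
  rfl

theorem hasDerivAt_line {F : Type*} [NormedAddCommGroup F] [NormedSpace ℝ F] (c a b : F) :
    HasDerivAt (fun t : ℝ ↦ (c, a + t • b)) (0, b) 0 := by
  refine (hasDerivAt_const _ _).prodMk ?_
  simpa using ((hasDerivAt_id (0 : ℝ)).smul_const b).const_add a

theorem verticalLift_eq (u : TangentBundle I M) (w : TangentSpace I u.1) :
    verticalLift u w = ((0, w) : E × E) := by
  have e : (fun t : ℝ ↦ (trivializationAt E (TangentSpace I) u.1
      (⟨u.1, u.2 + t • w⟩ : TangentBundle I M)).2) = fun t ↦ (u.2 : E) + t • (w : E) := by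
    ext t
    exact trivializationAt_snd _ _
  have hd : MDifferentiableAt 𝓘(ℝ, ℝ) I.tangent
      (fun t : ℝ ↦ (⟨u.1, u.2 + t • w⟩ : TangentBundle I M)) 0 := by
    refine (mdifferentiableAt_totalSpace (IB := I) _).2 ⟨mdifferentiableAt_const, ?_⟩
    rw [e]
    exact (hasDerivAt_line (F := E) (u.2 : E) (u.2 : E) (w : E)).differentiableAt.snd.mdifferentiableAt
  have hw : writtenInExtChartAt 𝓘(ℝ, ℝ) I.tangent 0
      (fun t : ℝ ↦ (⟨u.1, u.2 + t • w⟩ : TangentBundle I M)) =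
      fun t ↦ ((extChartAt I u.1 u.1, (u.2 : E) + t • (w : E)) : E × E) := by
    ext1 t
    refine (extChartAt_mk _ u.1 u.1 _ rfl).trans ?_
    exact congrArg (Prod.mk _) (congrFun e t)
  have h1 : HasDerivAt (fun t : ℝ ↦ ((extChartAt I u.1 u.1, (u.2 : E) + t • (w : E)) : E × E))
      (0, (w : E)) 0 := hasDerivAt_line (F := E) _ _ _
  have h2 := hd.mfderiv
  rw [hw] at h2
  have h3 := congrArg (fun L : ℝ →L[ℝ] E × E ↦ L 1) h2
  refine h3.trans ?_
  simp only [ModelWithCorners.range_eq_univ, fderivWithin_univ]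
  exact h1.deriv

theorem sectionLift_fst (u : TangentBundle I M) (v : TangentSpace I u.1) :
    ((mfderiv I I.tangent (fun q : M ↦ (⟨q, extend E u.2 q⟩ : TangentBundle I M)) u.1 :
      E →L[ℝ] E × E) v).1 = v := by
  have hd : MDifferentiableAt I I.tangent
      (fun q : M ↦ (⟨q, extend E u.2 q⟩ : TangentBundle I M)) u.1 :=
    mdifferentiableAt_extend I E u.2
  have h2 := hd.mfderiv
  have hd2 : DifferentiableWithinAt ℝ (writtenInExtChartAt I I.tangent u.1
      (fun q : M ↦ (⟨q, extend E u.2 q⟩ : TangentBundle I M))) (Set.range I)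
      (extChartAt I u.1 u.1) := by
    have := hd.differentiableWithinAt_writtenInExtChartAt
    exact this
  have h3 := congrArg (fun L : E →L[ℝ] E × E ↦ (L v).1) h2
  refine h3.trans ?_
  have h4 := hd2.hasFDerivWithinAt.fst
  have h5 : HasFDerivWithinAt (fun z : E ↦ z) (ContinuousLinearMap.id ℝ E) (Set.range I)
      (extChartAt I u.1 u.1) := hasFDerivWithinAt_id _ _
  have h6 := h5.congr_of_eventuallyEq (f₁ := fun z ↦ (writtenInExtChartAt I I.tangent u.1
      (fun q : M ↦ (⟨q, extend E u.2 q⟩ : TangentBundle I M)) z).1) ?_ ?_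
  · have h8 := UniqueDiffWithinAt.eq (I.uniqueDiffOn _ (Set.mem_range_self _)) h4 h6
    exact congrArg (fun L : E →L[ℝ] E ↦ L v) h8
  · filter_upwards [extChartAt_target_mem_nhdsWithin u.1] with z hz
    have := extChartAt_mk (I := I) (⟨u.1, extend E u.2 u.1⟩ : TangentBundle I M) u.1
      ((extChartAt I u.1).symm z) (extend E u.2 _) rfl
    exact (congrArg Prod.fst this).trans ((extChartAt I u.1).right_inv hz)
  · have := extChartAt_mk (I := I) (⟨u.1, extend E u.2 u.1⟩ : TangentBundle I M) u.1
      ((extChartAt I u.1).symm (extChartAt I u.1 u.1)) (extend E u.2 _) rfl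
    exact (congrArg Prod.fst this).trans
      ((extChartAt I u.1).right_inv (mem_extChartAt_target u.1))


theorem horizontalLift_eq (cov : Connection I M) (u : TangentBundle I M) :
    ∃ L : E →L[ℝ] E × E, (∀ v, (L v).1 = v) ∧
      ∀ v : E, (horizontalLift cov u v : E × E) = L v := by
  let D : E →L[ℝ] E × E :=
    mfderiv I I.tangent (fun q : M ↦ (⟨q, extend E u.2 q⟩ : TangentBundle I M)) u.1
  let C : E →L[ℝ] E := cov (extend E u.2) u.1
  refine ⟨D - (ContinuousLinearMap.inr ℝ E E).comp C, fun v ↦ ?_, fun v ↦ ?_⟩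
  · have : (D v).1 = v := sectionLift_fst u v
    simp [this]
  · exact congrArg (fun z : E × E ↦ D v - z) (verticalLift_eq u (C v))

theorem exists_liftEquiv (cov : Connection I M) (u : TangentBundle I M) :
    ∃ e : (E × E) ≃L[ℝ] E × E, ∀ p : E × E,
      e p = (horizontalLift cov u p.1 : E × E) + (verticalLift u p.2 : E × E) := by
  obtain ⟨L, hL, h⟩ := horizontalLift_eq cov u
  have hV : ∀ w : E, (verticalLift u w : E × E) = (0, w) := verticalLift_eq u
  refine ⟨ContinuousLinearEquiv.equivOfInverse
    (L.comp (ContinuousLinearMap.fst ℝ E E) +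
      (ContinuousLinearMap.inr ℝ E E).comp (ContinuousLinearMap.snd ℝ E E))
    ((ContinuousLinearMap.fst ℝ E E).prod (ContinuousLinearMap.snd ℝ E E -
      (ContinuousLinearMap.snd ℝ E E).comp (L.comp (ContinuousLinearMap.fst ℝ E E))))
    (fun p ↦ ?_) (fun p ↦ ?_), fun p ↦ ?_⟩
  · ext <;> simp [hL]
  · ext <;> simp [hL]
  · refine Eq.trans ?_ (congrArg₂ (fun a b : E × E ↦ a + b) (h p.1) (hV p.2)).symm
    simp

/-- The isomorphism `T_p M × T_p M ≃ T_u(TM)`, `(v, w) ↦ v^H + w^V`, for `u ∈ T_p M`. -/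
def liftEquiv (cov : Connection I M) (u : TangentBundle I M) :
    (TangentSpace I u.1 × TangentSpace I u.1) ≃L[ℝ] TangentSpace I.tangent u :=
  (exists_liftEquiv cov u).choose

theorem liftEquiv_apply (cov : Connection I M) (u : TangentBundle I M)
    (v w : TangentSpace I u.1) :
    liftEquiv cov u (v, w) = horizontalLift cov u v + verticalLift u w :=
  (exists_liftEquiv cov u).choose_spec (v, w)

/-- `J₁ : X^H ↦ -(J X)^H, X^V ↦ (J X)^V`, with the horizontal lifts of the Levi-Civita connection
of `g`. -/
def tangentJ₁ (g : BilinField I M) (J : EndoField I M) : EndoField I.tangent (TangentBundle I M) :=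
  fun u ↦
    let A : TangentSpace I u.1 × TangentSpace I u.1 →L[ℝ] TangentSpace I u.1 × TangentSpace I u.1 :=
      ((-J u.1) ∘L ContinuousLinearMap.fst ℝ _ _).prod (J u.1 ∘L ContinuousLinearMap.snd ℝ _ _)
    (liftEquiv (leviCivita g) u).toContinuousLinearMap ∘L A ∘L
      (liftEquiv (leviCivita g) u).symm.toContinuousLinearMap

/-- `J₂ : X^H ↦ X^V, X^V ↦ -X^H`, with the horizontal lifts of the Levi-Civita connection
of `g`. -/
def tangentJ₂ (g : BilinField I M) : EndoField I.tangent (TangentBundle I M) :=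
  fun u ↦
    let A : TangentSpace I u.1 × TangentSpace I u.1 →L[ℝ] TangentSpace I u.1 × TangentSpace I u.1 :=
      (-ContinuousLinearMap.snd ℝ _ _).prod (ContinuousLinearMap.fst ℝ _ _)
    (liftEquiv (leviCivita g) u).toContinuousLinearMap ∘L A ∘L
      (liftEquiv (leviCivita g) u).symm.toContinuousLinearMap

/-- `J₃ : X^H ↦ (J X)^V, X^V ↦ (J X)^H`, with the horizontal lifts of the Levi-Civita connection
of `g`. -/
def tangentJ₃ (g : BilinField I M) (J : EndoField I M) : EndoField I.tangent (TangentBundle I M) :=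
  fun u ↦
    let A : TangentSpace I u.1 × TangentSpace I u.1 →L[ℝ] TangentSpace I u.1 × TangentSpace I u.1 :=
      (J u.1 ∘L ContinuousLinearMap.snd ℝ _ _).prod (J u.1 ∘L ContinuousLinearMap.fst ℝ _ _)
    (liftEquiv (leviCivita g) u).toContinuousLinearMap ∘L A ∘L
      (liftEquiv (leviCivita g) u).symm.toContinuousLinearMap

/-- The complete lift of `g` to the tangent bundle:
`ĝ(X^H, Y^H) = ĝ(X^V, Y^V) = 0` and `ĝ(X^H, Y^V) = ĝ(X^V, Y^H) = g(X, Y)`. -/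
def completeLift (g : BilinField I M) : BilinField I.tangent (TangentBundle I M) :=
  fun u ↦
    let P : TangentSpace I.tangent u →L[ℝ] TangentSpace I u.1 :=
      ContinuousLinearMap.fst ℝ _ _ ∘L
        (liftEquiv (leviCivita g) u).symm.toContinuousLinearMap
    let K : TangentSpace I.tangent u →L[ℝ] TangentSpace I u.1 :=
      ContinuousLinearMap.snd ℝ _ _ ∘L
        (liftEquiv (leviCivita g) u).symm.toContinuousLinearMap
    ContinuousLinearMap.precomp ℝ K ∘L g u.1 ∘L P + ContinuousLinearMap.precomp ℝ P ∘L g u.1 ∘L K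

section Values

variable (g : BilinField I M) (J : EndoField I M) (u : TangentBundle I M) (v w : TangentSpace I u.1)

theorem verticalLift_zero : verticalLift u (0 : TangentSpace I u.1) = 0 := verticalLift_eq u 0

theorem horizontalLift_zero (cov : Connection I M) : horizontalLift cov u 0 = 0 := by
  obtain ⟨L, -, h⟩ := horizontalLift_eq cov u
  exact (h 0).trans (map_zero L)

theorem liftEquiv_symm_horizontalLift (cov : Connection I M) :
    (liftEquiv cov u).symm (horizontalLift cov u v) = (v, 0) := by
  rw [ContinuousLinearEquiv.symm_apply_eq, liftEquiv_apply, verticalLift_zero, add_zero]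

theorem liftEquiv_symm_verticalLift (cov : Connection I M) :
    (liftEquiv cov u).symm (verticalLift u v) = (0, v) := by
  rw [ContinuousLinearEquiv.symm_apply_eq, liftEquiv_apply, horizontalLift_zero, zero_add]

theorem tangentJ₁_horizontalLift : tangentJ₁ g J u (horizontalLift (leviCivita g) u v) =
    horizontalLift (leviCivita g) u (-(J u.1 v)) := by
  simp [tangentJ₁, liftEquiv_symm_horizontalLift, liftEquiv_apply, verticalLift_zero]

theorem tangentJ₁_verticalLift :
    tangentJ₁ g J u (verticalLift u v) = verticalLift u (J u.1 v) := by
  simp [tangentJ₁, liftEquiv_symm_verticalLift, liftEquiv_apply, horizontalLift_zero]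

theorem tangentJ₂_horizontalLift :
    tangentJ₂ g u (horizontalLift (leviCivita g) u v) = verticalLift u v := by
  simp [tangentJ₂, liftEquiv_symm_horizontalLift, liftEquiv_apply, horizontalLift_zero]

theorem tangentJ₂_verticalLift :
    tangentJ₂ g u (verticalLift u v) = horizontalLift (leviCivita g) u (-v) := by
  simp [tangentJ₂, liftEquiv_symm_verticalLift, liftEquiv_apply, verticalLift_zero]

theorem tangentJ₃_horizontalLift :
    tangentJ₃ g J u (horizontalLift (leviCivita g) u v) = verticalLift u (J u.1 v) := by
  simp [tangentJ₃, liftEquiv_symm_horizontalLift, liftEquiv_apply, horizontalLift_zero]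

theorem tangentJ₃_verticalLift :
    tangentJ₃ g J u (verticalLift u v) = horizontalLift (leviCivita g) u (J u.1 v) := by
  simp [tangentJ₃, liftEquiv_symm_verticalLift, liftEquiv_apply, verticalLift_zero]

theorem completeLift_horizontal_horizontal :
    completeLift g u (horizontalLift (leviCivita g) u v) (horizontalLift (leviCivita g) u w) = 0 := by
  simp [completeLift, liftEquiv_symm_horizontalLift]

theorem completeLift_vertical_vertical :
    completeLift g u (verticalLift u v) (verticalLift u w) = 0 := by
  simp [completeLift, liftEquiv_symm_verticalLift]

theorem completeLift_horizontal_vertical :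
    completeLift g u (horizontalLift (leviCivita g) u v) (verticalLift u w) = g u.1 v w := by
  simp [completeLift, liftEquiv_symm_horizontalLift, liftEquiv_symm_verticalLift]

theorem completeLift_vertical_horizontal :
    completeLift g u (verticalLift u v) (horizontalLift (leviCivita g) u w) = g u.1 v w := by
  simp [completeLift, liftEquiv_symm_horizontalLift, liftEquiv_symm_verticalLift]

end Values

end Tangent
end

/-!
For the Levi-Civita connection `D` of the complete lift and `ξ = s^H + t^V` at `u ∈ TM`,
`D_ξ a^H = (∇_s a)^H + (R(u, s) a)^V` and `D_ξ w^V = (∇_s w)^V`. Hence the derivative of an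
endomorphism of `TM` given by four blocks with respect to horizontal and vertical lifts consists of
the derivatives of the blocks and of curvature terms.

* The blocks of `J₂` are constant, so only curvature terms occur in `D J₂`.
* The Lee form is the trace of `(x, y) ↦ F(x, y, ·)` with respect to the metric. Vertical directions
  do not contribute to this trace, and what remains is the Lee form of the blocks on the base.
* If `∇J = 0`, then the structure tensor of `J₁` is `-2 g(J R(u, s) a, c)`. Since `J` commutes with
  `R`, this expression has the symmetries of a curvature tensor, and the exterior derivative of the
  Kähler form is its cyclic sum over `s, a, c`, which vanishes by the first Bianchi identity.
-/

noncomputable section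

set_option maxSynthPendingDepth 3

section ConstantFields

variable {E : Type*} [NormedAddCommGroup E] [NormedSpace ℝ E]

/-- The constant vector field `a` on a vector space. -/
def constField (a : E) : Π x : E, TangentSpace 𝓘(ℝ, E) x := fun _ ↦ a

theorem mdifferentiableAt_constField (a x : E) : MDiffAt (T% (constField a)) x :=
  (contMDiffAt_vectorSpace_iff_contDiffAt.2
    (contDiffAt_const (c := a) (n := 1))).mdifferentiableAt one_ne_zero

theorem mlieBracket_constField (a b x : E) :
    mlieBracket 𝓘(ℝ, E) (constField a) (constField b) x = 0 := by
  rw [← mlieBracketWithin_univ, mlieBracketWithin_eq_lieBracketWithin]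
  have hconst : lieBracketWithin ℝ (fun _ : E ↦ a) (fun _ ↦ b) Set.univ x = 0 := by
    simp [lieBracketWithin]
  exact hconst

end ConstantFields

section ChartFrames

variable {E : Type*} [NormedAddCommGroup E] [NormedSpace ℝ E]
  {H : Type*} [TopologicalSpace H] {I : ModelWithCorners ℝ E H}
  {M : Type*} [TopologicalSpace M] [ChartedSpace H M] {x₀ q : M}

theorem extChartAt_symm_mem_source {x : E} (hx : x ∈ (extChartAt I x₀).target) :
    (extChartAt I x₀).symm x ∈ (chartAt H x₀).source := by
  simpa only [extChartAt_source] using (extChartAt I x₀).map_target hx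

theorem extChartAt_mem_target (hq : q ∈ (chartAt H x₀).source) :
    extChartAt I x₀ q ∈ (extChartAt I x₀).target :=
  (extChartAt I x₀).map_source (by rwa [extChartAt_source])

theorem extChartAt_symm_apply (hq : q ∈ (chartAt H x₀).source) :
    (extChartAt I x₀).symm (extChartAt I x₀ q) = q :=
  (extChartAt I x₀).left_inv (by rwa [extChartAt_source])

theorem extChartAt_target_mem_nhds_of_mem [I.Boundaryless] {x : E}
    (hx : x ∈ (extChartAt I x₀).target) :
    (extChartAt I x₀).target ∈ 𝓝 x :=
  (isOpen_extChartAt_target x₀).mem_nhds hx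

variable [IsManifold I ∞ M]

variable (I) in
/-- The coordinate frame at `q` of the chart centred at `x₀`, as a linear map from the model space
to the tangent space. -/
def chartFrame (x₀ q : M) : E →L[ℝ] TangentSpace I q :=
  (trivializationAt E (TangentSpace I) x₀).symmL ℝ q

variable (I) in
/-- The components at `q` of a tangent vector in the chart centred at `x₀`. -/
def chartCoord (x₀ q : M) : TangentSpace I q →L[ℝ] E :=
  (trivializationAt E (TangentSpace I) x₀).continuousLinearMapAt ℝ q

variable (I) in
/-- The vector field with constant components `a` in the chart centred at `x₀`. -/
def chartField (x₀ : M) (a : E) : Π q : M, TangentSpace I q := fun q ↦ chartFrame I x₀ q a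

theorem chartCoord_chartFrame (hq : q ∈ (chartAt H x₀).source) (a : E) :
    chartCoord I x₀ q (chartFrame I x₀ q a) = a :=
  (trivializationAt E (TangentSpace I) x₀).continuousLinearMapAt_symmL hq a

theorem chartFrame_chartCoord (hq : q ∈ (chartAt H x₀).source) (v : TangentSpace I q) :
    chartFrame I x₀ q (chartCoord I x₀ q v) = v :=
  (trivializationAt E (TangentSpace I) x₀).symmL_continuousLinearMapAt hq v

theorem chartCoord_eq_snd (hq : q ∈ (chartAt H x₀).source) (v : TangentSpace I q) :
    chartCoord I x₀ q v =
      (trivializationAt E (TangentSpace I) x₀ (⟨q, v⟩ : TangentBundle I M)).2 :=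
  congrFun ((trivializationAt E (TangentSpace I) x₀).coe_linearMapAt_of_mem (R := ℝ) hq) v

theorem chartCoord_self (x₀ : M) (v : TangentSpace I x₀) : chartCoord I x₀ x₀ v = v :=
  (chartCoord_eq_snd (mem_chart_source H x₀) v).trans (trivializationAt_snd x₀ v)

theorem extend_eq_chartField (hq : q ∈ (chartAt H x₀).source) (v : TangentSpace I x₀) :
    extend E v q = chartField I x₀ v q := by
  refine Eq.trans ?_ (congrArg (fun w : E ↦ chartFrame I x₀ q w) (trivializationAt_snd x₀ v))
  exact ((trivializationAt E (TangentSpace I) x₀).symmₗ_apply (R := ℝ) hq _).symm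

theorem chartCoord_extend (hq : q ∈ (chartAt H x₀).source) (v : TangentSpace I x₀) :
    chartCoord I x₀ q (extend E v q) = v := by
  rw [extend_eq_chartField hq]
  exact chartCoord_chartFrame (E := E) hq v

theorem extend_eventuallyEq_chartField (hq : q ∈ (chartAt H x₀).source) (v : TangentSpace I x₀) :
    ∀ᶠ y in 𝓝 q, extend E v y = chartField I x₀ v y :=
  Filter.eventually_of_mem ((chartAt H x₀).open_source.mem_nhds hq)
    fun _ hy ↦ extend_eq_chartField hy v

theorem contMDiffAt_chartField (hq : q ∈ (chartAt H x₀).source) (a : E) :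
    CMDiffAt ∞ (T% (chartField I x₀ a)) q := by
  refine ((trivializationAt E (TangentSpace I) x₀).contMDiffAt_section_iff hq).2 ?_
  refine (contMDiffAt_const (c := a)).congr_of_eventuallyEq ?_
  filter_upwards [(chartAt H x₀).open_source.mem_nhds hq] with y hy
  rw [← chartCoord_eq_snd hy]
  exact chartCoord_chartFrame hy a

theorem mdifferentiableAt_chartField (hq : q ∈ (chartAt H x₀).source) (a : E) :
    MDiffAt (T% (chartField I x₀ a)) q :=
  (contMDiffAt_chartField hq a).mdifferentiableAt (by simp)

theorem mdifferentiableAt_extend_of_mem (hq : q ∈ (chartAt H x₀).source) (v : TangentSpace I x₀) :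
    MDiffAt (T% (extend E v)) q :=
  (mdifferentiableAt_chartField (E := E) hq v).congr_of_eventuallyEq <|
    (extend_eventuallyEq_chartField hq v).mono fun y ↦ congrArg (TotalSpace.mk' E y)

variable {F : Type*} [NormedAddCommGroup F] [NormedSpace ℝ F] {f : M → F}

theorem mdifferentiableAt_of_comp_extChartAt_symm (hq : q ∈ (chartAt H x₀).source)
    (hf : DifferentiableAt ℝ (fun x ↦ f ((extChartAt I x₀).symm x)) (extChartAt I x₀ q)) :
    MDifferentiableAt I 𝓘(ℝ, F) f q := by
  refine (hf.mdifferentiableAt.comp q (mdifferentiableAt_extChartAt hq)).congr_of_eventuallyEq ?_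
  filter_upwards [(chartAt H x₀).open_source.mem_nhds hq] with y hy
  exact congrArg f (extChartAt_symm_apply hy).symm

theorem contMDiffAt_of_comp_extChartAt_symm (hq : q ∈ (chartAt H x₀).source)
    (hf : ContDiffAt ℝ ∞ (fun x ↦ f ((extChartAt I x₀).symm x)) (extChartAt I x₀ q)) :
    ContMDiffAt I 𝓘(ℝ, F) ∞ f q := by
  refine (hf.contMDiffAt.comp q (contMDiffAt_extChartAt' hq)).congr_of_eventuallyEq ?_
  filter_upwards [(chartAt H x₀).open_source.mem_nhds hq] with y hy
  exact congrArg f (extChartAt_symm_apply hy).symm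

theorem chartField_eventuallyEq_mpullback (hq : q ∈ (chartAt H x₀).source) (a : E) :
    ∀ᶠ y in 𝓝 q, chartField I x₀ a y =
      mpullback I 𝓘(ℝ, E) (extChartAt I x₀) (constField a) y := by
  filter_upwards [(chartAt H x₀).open_source.mem_nhds hq] with y hy
  have hcoord : chartCoord I x₀ y = mfderiv I 𝓘(ℝ, E) (extChartAt I x₀) y :=
    TangentBundle.continuousLinearMapAt_trivializationAt hy
  obtain ⟨e, he⟩ := isInvertible_mfderiv_extChartAt (I := I) (x := x₀) (y := y)
    (by rwa [extChartAt_source])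
  rw [mpullback_apply, ← he, ContinuousLinearMap.inverse_equiv]
  refine (e.symm_apply_eq.2 ?_).symm
  have h := chartCoord_chartFrame (I := I) hy a
  rw [hcoord, ← he] at h
  exact h.symm

theorem mlieBracket_chartField [FiniteDimensional ℝ E] (hq : q ∈ (chartAt H x₀).source) (a b : E) :
    mlieBracket I (chartField I x₀ a) (chartField I x₀ b) q = 0 := by
  have := FiniteDimensional.complete ℝ E
  have hmin : minSmoothness ℝ 2 ≤ ∞ := by simpa using ENat.LEInfty.out
  have : IsManifold I (minSmoothness ℝ 2) M := .of_le hmin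
  rw [Filter.EventuallyEq.mlieBracket_vectorField_eq (chartField_eventuallyEq_mpullback hq a)
      (chartField_eventuallyEq_mpullback hq b),
    ← mpullback_mlieBracket (n := ∞) (mdifferentiableAt_constField a _)
      (mdifferentiableAt_constField b _) (contMDiffAt_extChartAt' hq) hmin,
    mpullback_apply, mlieBracket_constField, map_zero]

theorem mlieBracket_extend [FiniteDimensional ℝ E] (v w : TangentSpace I q) :
    mlieBracket I (extend E v) (extend E w) q = 0 :=
  (Filter.EventuallyEq.mlieBracket_vectorField_eq
    (extend_eventuallyEq_chartField (mem_chart_source H q) v)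
    (extend_eventuallyEq_chartField (mem_chart_source H q) w)).trans
      (mlieBracket_chartField (mem_chart_source H q) _ _)

section Boundaryless

variable [I.Boundaryless]

theorem contMDiffAt_extChartAt_symm {x : E} (hx : x ∈ (extChartAt I x₀).target) :
    ContMDiffAt 𝓘(ℝ, E) I ∞ (extChartAt I x₀).symm x :=
  (contMDiffOn_extChartAt_symm x₀).contMDiffAt (extChartAt_target_mem_nhds_of_mem hx)

theorem contDiffAt_comp_extChartAt_symm {x : E} (hx : x ∈ (extChartAt I x₀).target)
    (hf : ContMDiffAt I 𝓘(ℝ, F) ∞ f ((extChartAt I x₀).symm x)) :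
    ContDiffAt ℝ ∞ (fun x ↦ f ((extChartAt I x₀).symm x)) x :=
  contMDiffAt_iff_contDiffAt.1 (hf.comp x (contMDiffAt_extChartAt_symm hx))

theorem differentiableAt_comp_extChartAt_symm (hq : q ∈ (chartAt H x₀).source)
    (hf : MDifferentiableAt I 𝓘(ℝ, F) f q) :
    DifferentiableAt ℝ (fun x ↦ f ((extChartAt I x₀).symm x)) (extChartAt I x₀ q) := by
  rw [← extChartAt_symm_apply (I := I) hq] at hf
  exact mdifferentiableAt_iff_differentiableAt.1 (hf.comp _
    ((contMDiffAt_extChartAt_symm (extChartAt_mem_target hq)).mdifferentiableAt (by simp)))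

theorem chartFrame_eq_mfderiv {x : E} (hx : x ∈ (extChartAt I x₀).target) :
    chartFrame I x₀ ((extChartAt I x₀).symm x) =
      mfderiv 𝓘(ℝ, E) I (extChartAt I x₀).symm x := by
  refine (TangentBundle.symmL_trivializationAt (extChartAt_symm_mem_source hx)).trans ?_
  rw [ModelWithCorners.range_eq_univ, mfderivWithin_univ, (extChartAt I x₀).right_inv hx]

theorem mvfderiv_chartFrame (hq : q ∈ (chartAt H x₀).source)
    (hf : MDifferentiableAt I 𝓘(ℝ, F) f q) (a : E) :
    d% f q (chartFrame I x₀ q a) =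
      fderiv ℝ (fun x ↦ f ((extChartAt I x₀).symm x)) (extChartAt I x₀ q) a := by
  have hx := extChartAt_mem_target (I := I) hq
  have key : d% f ((extChartAt I x₀).symm (extChartAt I x₀ q)) (chartFrame I x₀ _ a) =
      fderiv ℝ (fun x ↦ f ((extChartAt I x₀).symm x)) (extChartAt I x₀ q) a := by
    rw [← extChartAt_symm_apply (I := I) hq] at hf
    rw [chartFrame_eq_mfderiv hx, ← mfderiv_eq_fderiv]
    exact congr($(mfderiv_comp (extChartAt I x₀ q) hf
      ((contMDiffAt_extChartAt_symm hx).mdifferentiableAt (by simp))) a).symm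
  rwa [extChartAt_symm_apply hq] at key

end Boundaryless

end ChartFrames

section BilinearCalculus

variable {F F₁ F₂ F₃ : Type*} [NormedAddCommGroup F] [NormedSpace ℝ F]
  [NormedAddCommGroup F₁] [NormedSpace ℝ F₁] [NormedAddCommGroup F₂] [NormedSpace ℝ F₂]
  [NormedAddCommGroup F₃] [NormedSpace ℝ F₃] {x : F}

theorem fderiv_clm_apply_apply {A : F → F₁ →L[ℝ] F₂} {s : F → F₁} (hA : DifferentiableAt ℝ A x)
    (hs : DifferentiableAt ℝ s x) (a : F) :
    fderiv ℝ (fun x ↦ A x (s x)) x a = fderiv ℝ A x a (s x) + A x (fderiv ℝ s x a) := by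
  rw [fderiv_clm_apply hA hs, add_comm]
  rfl

variable {B : F → F₁ →L[ℝ] F₂ →L[ℝ] F₃}

theorem fderiv_clm_apply₂ (hB : DifferentiableAt ℝ B x) {s : F → F₁} {t : F → F₂}
    (hs : DifferentiableAt ℝ s x) (ht : DifferentiableAt ℝ t x) (a : F) :
    fderiv ℝ (fun x ↦ B x (s x) (t x)) x a =
      fderiv ℝ B x a (s x) (t x) + B x (fderiv ℝ s x a) (t x) + B x (s x) (fderiv ℝ t x a) := by
  rw [fderiv_clm_apply_apply (hB.clm_apply hs) ht, fderiv_clm_apply_apply hB hs, add_apply]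

theorem fderiv_clm_apply_const₂ (hB : DifferentiableAt ℝ B x) (a : F) (b : F₁) (c : F₂) :
    fderiv ℝ (fun x ↦ B x b c) x a = fderiv ℝ B x a b c := by
  simp [fderiv_clm_apply₂ hB (differentiableAt_const b) (differentiableAt_const c)]

theorem fderiv_symm_of_forall_mem {B : F → F₁ →L[ℝ] F₁ →L[ℝ] F₂} {U : Set F} (hU : IsOpen U)
    (hx : x ∈ U) (hB : DifferentiableAt ℝ B x) (hsymm : ∀ y ∈ U, ∀ b c, B y b c = B y c b)
    (a : F) (b c : F₁) : fderiv ℝ B x a b c = fderiv ℝ B x a c b := by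
  have h : Set.EqOn (fun y ↦ B y b c) (fun y ↦ B y c b) U := fun y hy ↦ hsymm y hy b c
  rw [← fderiv_clm_apply_const₂ hB, ← fderiv_clm_apply_const₂ hB,
    (h.eventuallyEq_of_mem (hU.mem_nhds hx)).fderiv_eq]

end BilinearCalculus

section LocalMetrics

variable {E : Type*} [NormedAddCommGroup E] [NormedSpace ℝ E]

/-- A smooth nondegenerate symmetric bilinear form depending on the point of an open set `U`. -/
structure IsLocalMetric (U : Set E) (G : E → E →L[ℝ] E →L[ℝ] ℝ) : Prop where
  isOpen : IsOpen U
  contDiffOn : ContDiffOn ℝ ∞ G U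
  symm : ∀ x ∈ U, ∀ a b, G x a b = G x b a
  nondegenerate : ∀ x ∈ U, ∀ a, (∀ b, G x a b = 0) → a = 0

/-- Twice the Christoffel symbols of the first kind of the local metric `G`. -/
def koszulForm (G : E → E →L[ℝ] E →L[ℝ] ℝ) (x : E) : E →L[ℝ] E →L[ℝ] E →L[ℝ] ℝ :=
  fderiv ℝ G x + (fderiv ℝ G x).flip -
    (ContinuousLinearMap.flipₗᵢ ℝ E E ℝ).toContinuousLinearEquiv.toContinuousLinearMap ∘L
      (fderiv ℝ G x).flip

/-- The Christoffel symbols of the local metric `G`, as the bilinear map `(a, b) ↦ Γ(a, b)`. -/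
def christoffel (G : E → E →L[ℝ] E →L[ℝ] ℝ) (x : E) : E →L[ℝ] E →L[ℝ] E :=
  (1 / 2 : ℝ) • ContinuousLinearMap.compL ℝ E (E →L[ℝ] ℝ) E (G x).inverse ∘L koszulForm G x

/-- The covariant derivative `a ↦ ∇_a Y` of a vector field for the local metric `G`. -/
def localCovDeriv (G : E → E →L[ℝ] E →L[ℝ] ℝ) (Y : E → E) (x : E) : E →L[ℝ] E :=
  fderiv ℝ Y x + (christoffel G x).flip (Y x)

/-- The covariant derivative `(a, b) ↦ (∇_a J) b` of a field of endomorphisms for the local metric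
`G`. -/
def localCovDerivEndo (G : E → E →L[ℝ] E →L[ℝ] ℝ) (J : E → E →L[ℝ] E) (x : E) :
    E →L[ℝ] E →L[ℝ] E :=
  fderiv ℝ J x + (ContinuousLinearMap.compL ℝ E E E).flip (J x) ∘L christoffel G x -
    ContinuousLinearMap.compL ℝ E E E (J x) ∘L christoffel G x

/-- The curvature `R(a, b)c` of the local metric `G`. -/
def localCurvature (G : E → E →L[ℝ] E →L[ℝ] ℝ) (x a b c : E) : E :=
  fderiv ℝ (christoffel G) x a b c - fderiv ℝ (christoffel G) x b a c
    + christoffel G x a (christoffel G x b c) - christoffel G x b (christoffel G x a c)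

variable {G : E → E →L[ℝ] E →L[ℝ] ℝ} {J : E → E →L[ℝ] E}

theorem koszulForm_apply (x a b c : E) :
    koszulForm G x a b c = fderiv ℝ G x a b c + fderiv ℝ G x b a c - fderiv ℝ G x c a b := rfl

theorem christoffel_apply (x a b : E) :
    christoffel G x a b = (1 / 2 : ℝ) • (G x).inverse (koszulForm G x a b) := rfl

theorem localCovDeriv_apply (Y : E → E) (x a : E) :
    localCovDeriv G Y x a = fderiv ℝ Y x a + christoffel G x a (Y x) := rfl

theorem localCovDerivEndo_apply (x a b : E) :
    localCovDerivEndo G J x a b =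
      fderiv ℝ J x a b + christoffel G x a (J x b) - J x (christoffel G x a b) := rfl

theorem localCovDeriv_congr {Y Z : E → E} {x : E} (h : Y =ᶠ[𝓝 x] Z) :
    localCovDeriv G Y x = localCovDeriv G Z x := by
  rw [localCovDeriv, localCovDeriv, h.fderiv_eq, h.eq_of_nhds]

theorem localCovDeriv_add {Y Z : E → E} {x : E} (hY : DifferentiableAt ℝ Y x)
    (hZ : DifferentiableAt ℝ Z x) :
    localCovDeriv G (fun x ↦ Y x + Z x) x = localCovDeriv G Y x + localCovDeriv G Z x := by
  rw [localCovDeriv, localCovDeriv, localCovDeriv, fderiv_fun_add hY hZ, map_add]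
  abel

theorem localCovDeriv_endo_apply {Y : E → E} {x : E} (hJ : DifferentiableAt ℝ J x)
    (hY : DifferentiableAt ℝ Y x) (a : E) :
    localCovDeriv G (fun x ↦ J x (Y x)) x a =
      localCovDerivEndo G J x a (Y x) + J x (localCovDeriv G Y x a) := by
  rw [localCovDeriv_apply, fderiv_clm_apply_apply hJ hY, localCovDerivEndo_apply,
    localCovDeriv_apply, map_add]
  abel

theorem isInvertible_of_nondegenerate [FiniteDimensional ℝ E] {B : E →L[ℝ] E →L[ℝ] ℝ}
    (hB : ∀ a, (∀ b, B a b = 0) → a = 0) : B.IsInvertible := by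
  obtain ⟨S, hS⟩ := exists_sharp B hB
  refine ⟨ContinuousLinearEquiv.equivOfInverse B S (fun a ↦ ?_) (fun φ ↦ ?_), ?_⟩
  · exact sub_eq_zero.1 (hB _ fun b ↦ by simp [hS])
  · ext b; exact hS φ b
  · ext; rfl

theorem fderiv_endo_apply {x : E} (hparallel : localCovDerivEndo G J x = 0) (a b : E) :
    fderiv ℝ J x a b = J x (christoffel G x a b) - christoffel G x a (J x b) := by
  have h := congr($hparallel a b)
  rw [localCovDerivEndo_apply, zero_apply, zero_apply] at h
  rw [← sub_eq_zero, ← h]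
  abel

namespace IsLocalMetric

variable {U : Set E} (hG : IsLocalMetric U G) {x : E} (hx : x ∈ U)

include hG

theorem contDiffOn_fderiv : ContDiffOn ℝ ∞ (fderiv ℝ G) U :=
  hG.contDiffOn.fderiv_of_isOpen hG.isOpen (by simp)

include hx

theorem contDiffAt : ContDiffAt ℝ ∞ G x := hG.contDiffOn.contDiffAt (hG.isOpen.mem_nhds hx)

theorem differentiableAt : DifferentiableAt ℝ G x :=
  (hG.contDiffAt hx).differentiableAt (by simp)

theorem differentiableAt_fderiv : DifferentiableAt ℝ (fderiv ℝ G) x :=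
  (hG.contDiffOn_fderiv.contDiffAt (hG.isOpen.mem_nhds hx)).differentiableAt (by simp)

theorem ext {v w : E} (h : ∀ c, G x v c = G x w c) : v = w :=
  sub_eq_zero.1 (hG.nondegenerate x hx _ fun c ↦ by simp [h c])

theorem fderiv_symm (a b c : E) : fderiv ℝ G x a b c = fderiv ℝ G x a c b :=
  fderiv_symm_of_forall_mem hG.isOpen hx (hG.differentiableAt hx) hG.symm a b c

theorem fderiv_fderiv_comm (a b : E) :
    fderiv ℝ (fderiv ℝ G) x a b = fderiv ℝ (fderiv ℝ G) x b a :=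
  (ContDiffAt.isSymmSndFDerivAt (hG.contDiffAt hx) (by simpa using ENat.LEInfty.out)).eq a b

variable [FiniteDimensional ℝ E]

omit hx in
theorem contDiffOn_christoffel : ContDiffOn ℝ ∞ (christoffel G) U := by
  have := FiniteDimensional.complete ℝ E
  have hinv : ContDiffOn ℝ ∞ (fun x ↦ (G x).inverse) U := fun x hx ↦ by
    obtain ⟨e, he⟩ := isInvertible_of_nondegenerate (hG.nondegenerate x hx)
    have h := contDiffAt_map_inverse (𝕜 := ℝ) (n := ∞) e
    rw [he] at h
    exact (h.comp x (hG.contDiffOn.contDiffAt (hG.isOpen.mem_nhds hx))).contDiffWithinAt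
  have hcoeff (a b c : E) : ContDiffOn ℝ ∞ (fun x ↦ fderiv ℝ G x a b c) U :=
    ((hG.contDiffOn_fderiv.clm_apply contDiffOn_const).clm_apply contDiffOn_const).clm_apply
      contDiffOn_const
  refine contDiffOn_clm_apply.2 fun a ↦ contDiffOn_clm_apply.2 fun b ↦ ?_
  refine contDiffOn_const.smul (hinv.clm_apply (contDiffOn_clm_apply.2 fun c ↦ ?_))
  exact ((hcoeff a b c).add (hcoeff b a c)).sub (hcoeff c a b)

theorem differentiableAt_christoffel : DifferentiableAt ℝ (christoffel G) x :=
  (hG.contDiffOn_christoffel.contDiffAt (hG.isOpen.mem_nhds hx)).differentiableAt (by simp)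

theorem two_mul_christoffel (a b c : E) : 2 * G x (christoffel G x a b) c =
    fderiv ℝ G x a b c + fderiv ℝ G x b a c - fderiv ℝ G x c a b := by
  obtain ⟨e, he⟩ := isInvertible_of_nondegenerate (hG.nondegenerate x hx)
  rw [christoffel_apply, map_smul, ← he, ContinuousLinearMap.inverse_equiv]
  simp [koszulForm_apply]

theorem eq_christoffel {a b v : E} (h : ∀ c, 2 * G x v c =
    fderiv ℝ G x a b c + fderiv ℝ G x b a c - fderiv ℝ G x c a b) : v = christoffel G x a b :=
  hG.ext hx fun c ↦ by linarith [h c, hG.two_mul_christoffel hx a b c]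

theorem christoffel_symm (a b : E) : christoffel G x a b = christoffel G x b a := by
  refine hG.eq_christoffel hx fun c ↦ ?_
  rw [hG.two_mul_christoffel hx, hG.fderiv_symm hx c a b]
  ring

theorem fderiv_christoffel_symm (a b c : E) :
    fderiv ℝ (christoffel G) x a b c = fderiv ℝ (christoffel G) x a c b :=
  fderiv_symm_of_forall_mem hG.isOpen hx (hG.differentiableAt_christoffel hx)
    (fun _ hy ↦ hG.christoffel_symm hy) a b c

theorem fderiv_apply_eq_christoffel (a b c : E) : fderiv ℝ G x a b c =
    G x (christoffel G x a b) c + G x b (christoffel G x a c) := by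
  rw [hG.symm x hx b]
  linarith [hG.two_mul_christoffel hx a b c, hG.two_mul_christoffel hx a c b,
    hG.fderiv_symm hx a b c, hG.fderiv_symm hx b a c, hG.fderiv_symm hx c a b]

theorem localCurvature_cyclic_sum (a b c : E) :
    localCurvature G x a b c + localCurvature G x b c a + localCurvature G x c a b = 0 := by
  simp only [localCurvature, hG.christoffel_symm hx c, hG.christoffel_symm hx b a,
    hG.fderiv_christoffel_symm hx _ c, hG.fderiv_christoffel_symm hx c b a]
  abel

theorem fderiv_fderiv_apply (a b c d : E) : fderiv ℝ (fderiv ℝ G) x a b c d =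
    fderiv ℝ G x a (christoffel G x b c) d + G x (fderiv ℝ (christoffel G) x a b c) d +
      (fderiv ℝ G x a c (christoffel G x b d) + G x c (fderiv ℝ (christoffel G) x a b d)) := by
  have hD := hG.differentiableAt_fderiv hx
  have hd := hG.differentiableAt hx
  have hΓ (b c : E) : DifferentiableAt ℝ (fun y ↦ christoffel G y b c) x :=
    ((hG.differentiableAt_christoffel hx).clm_apply (differentiableAt_const b)).clm_apply
      (differentiableAt_const c)
  have hmetric : Set.EqOn (fun y ↦ fderiv ℝ G y b c d)
      (fun y ↦ G y (christoffel G y b c) d + G y c (christoffel G y b d)) U :=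
    fun y hy ↦ hG.fderiv_apply_eq_christoffel hy b c d
  have hleft : fderiv ℝ (fun y ↦ fderiv ℝ G y b c d) x a = fderiv ℝ (fderiv ℝ G) x a b c d := by
    rw [fderiv_clm_apply_const₂ (hD.clm_apply (differentiableAt_const b)),
      fderiv_clm_apply_apply hD (differentiableAt_const b)]
    simp
  rw [← hleft, (hmetric.eventuallyEq_of_mem (hG.isOpen.mem_nhds hx)).fderiv_eq,
    fderiv_fun_add ((hd.clm_apply (hΓ b c)).clm_apply (differentiableAt_const d))
      ((hd.clm_apply (differentiableAt_const c)).clm_apply (hΓ b d)), add_apply,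
    fderiv_clm_apply₂ hd (hΓ b c) (differentiableAt_const d),
    fderiv_clm_apply₂ hd (differentiableAt_const c) (hΓ b d)]
  simp [fderiv_clm_apply_const₂ (hG.differentiableAt_christoffel hx)]

theorem localCurvature_skew (a b c d : E) :
    G x (localCurvature G x a b c) d = -G x c (localCurvature G x a b d) := by
  have h := congr($(hG.fderiv_fderiv_comm hx a b) c d)
  simp only [hG.fderiv_fderiv_apply hx, hG.fderiv_apply_eq_christoffel hx] at h
  simp only [localCurvature, map_add, map_sub, add_apply, sub_apply]
  linarith

theorem fderiv_fderiv_endo_apply (hJ : ContDiffAt ℝ ∞ J x)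
    (hparallel : ∀ y ∈ U, localCovDerivEndo G J y = 0) (a b c : E) :
    fderiv ℝ (fderiv ℝ J) x a b c =
      fderiv ℝ J x a (christoffel G x b c) + J x (fderiv ℝ (christoffel G) x a b c) -
        (fderiv ℝ (christoffel G) x a b (J x c) + christoffel G x b (fderiv ℝ J x a c)) := by
  have hJd : DifferentiableAt ℝ J x := hJ.differentiableAt (by simp)
  have hJ' : DifferentiableAt ℝ (fderiv ℝ J) x :=
    (hJ.fderiv_right (m := ∞) (by simp)).differentiableAt (by simp)
  have hΓ := hG.differentiableAt_christoffel hx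
  have hΓb := hΓ.clm_apply (differentiableAt_const b)
  have hc := differentiableAt_const (𝕜 := ℝ) (x := x) c
  have hfderiv : Set.EqOn (fun y ↦ fderiv ℝ J y b c)
      (fun y ↦ J y (christoffel G y b c) - christoffel G y b (J y c)) U :=
    fun y hy ↦ fderiv_endo_apply (hparallel y hy) b c
  rw [← fderiv_clm_apply_const₂ hJ',
    (hfderiv.eventuallyEq_of_mem (hG.isOpen.mem_nhds hx)).fderiv_eq,
    fderiv_fun_sub (hJd.clm_apply (hΓb.clm_apply hc)) (hΓb.clm_apply (hJd.clm_apply hc)),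
    sub_apply, fderiv_clm_apply_apply hJd (hΓb.clm_apply hc),
    fderiv_clm_apply₂ hΓ (differentiableAt_const b) (hJd.clm_apply hc),
    fderiv_clm_apply_const₂ hΓ, fderiv_clm_apply_apply hJd hc]
  simp

theorem localCurvature_endo_comm (hJ : ContDiffAt ℝ ∞ J x)
    (hparallel : ∀ y ∈ U, localCovDerivEndo G J y = 0) (a b c : E) :
    localCurvature G x a b (J x c) = J x (localCurvature G x a b c) := by
  have hcomm := congr($((hJ.isSymmSndFDerivAt (by simpa using ENat.LEInfty.out)).eq a b) c)
  rw [hG.fderiv_fderiv_endo_apply hx hJ hparallel, hG.fderiv_fderiv_endo_apply hx hJ hparallel]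
    at hcomm
  simp only [fderiv_endo_apply (hparallel x hx), map_sub] at hcomm
  rw [← sub_eq_zero] at hcomm ⊢
  rw [← neg_eq_zero, ← hcomm]
  simp only [localCurvature, map_add, map_sub]
  abel

end IsLocalMetric

end LocalMetrics

section ChartExpressions

variable {E : Type*} [NormedAddCommGroup E] [NormedSpace ℝ E]
  {H : Type*} [TopologicalSpace H] {I : ModelWithCorners ℝ E H}
  {M : Type*} [TopologicalSpace M] [ChartedSpace H M] [IsManifold I ∞ M]

/-- The expression of a field of bilinear forms in the chart centred at `x₀`. -/
def localBilin (g : BilinField I M) (x₀ : M) (x : E) : E →L[ℝ] E →L[ℝ] ℝ :=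
  ContinuousLinearMap.precomp ℝ (chartFrame I x₀ ((extChartAt I x₀).symm x)) ∘L
    g ((extChartAt I x₀).symm x) ∘L chartFrame I x₀ ((extChartAt I x₀).symm x)

/-- The expression of a field of endomorphisms in the chart centred at `x₀`. -/
def localEndo (J : EndoField I M) (x₀ : M) (x : E) : E →L[ℝ] E :=
  chartCoord I x₀ ((extChartAt I x₀).symm x) ∘L J ((extChartAt I x₀).symm x) ∘L
    chartFrame I x₀ ((extChartAt I x₀).symm x)

/-- The expression of a vector field in the chart centred at `x₀`. -/
def localField (σ : Π q : M, TangentSpace I q) (x₀ : M) (x : E) : E :=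
  chartCoord I x₀ ((extChartAt I x₀).symm x) (σ ((extChartAt I x₀).symm x))

variable {g : BilinField I M} {J : EndoField I M} {x₀ q : M}

theorem localBilin_apply (x a b : E) : localBilin g x₀ x a b =
    g ((extChartAt I x₀).symm x) (chartFrame I x₀ _ a) (chartFrame I x₀ _ b) := rfl

theorem localEndo_apply (x a : E) : localEndo J x₀ x a =
    chartCoord I x₀ ((extChartAt I x₀).symm x) (J _ (chartFrame I x₀ _ a)) := rfl

theorem localBilin_extChartAt (hq : q ∈ (chartAt H x₀).source) (a b : E) :
    localBilin g x₀ (extChartAt I x₀ q) a b =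
      g q (chartFrame I x₀ q a) (chartFrame I x₀ q b) := by
  rw [localBilin_apply, extChartAt_symm_apply hq]

theorem localBilin_chartCoord (hq : q ∈ (chartAt H x₀).source) (v w : TangentSpace I q) :
    localBilin g x₀ (extChartAt I x₀ q) (chartCoord I x₀ q v) (chartCoord I x₀ q w) =
      g q v w := by
  rw [localBilin_extChartAt hq, chartFrame_chartCoord hq, chartFrame_chartCoord hq]

theorem localEndo_extChartAt (hq : q ∈ (chartAt H x₀).source) (a : E) :
    localEndo J x₀ (extChartAt I x₀ q) a = chartCoord I x₀ q (J q (chartFrame I x₀ q a)) := by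
  rw [localEndo_apply, extChartAt_symm_apply hq]

theorem localEndo_chartCoord (hq : q ∈ (chartAt H x₀).source) (v : TangentSpace I q) :
    localEndo J x₀ (extChartAt I x₀ q) (chartCoord I x₀ q v) = chartCoord I x₀ q (J q v) := by
  rw [localEndo_extChartAt hq, chartFrame_chartCoord hq]

theorem localField_extChartAt (σ : Π q : M, TangentSpace I q) (hq : q ∈ (chartAt H x₀).source) :
    localField σ x₀ (extChartAt I x₀ q) = chartCoord I x₀ q (σ q) := by
  rw [localField, extChartAt_symm_apply hq]

theorem localField_chartField (a : E) {x : E} (hx : x ∈ (extChartAt I x₀).target) :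
    localField (chartField I x₀ a) x₀ x = a :=
  chartCoord_chartFrame (extChartAt_symm_mem_source hx) a

theorem localField_extend (v : TangentSpace I x₀) {x : E} (hx : x ∈ (extChartAt I x₀).target) :
    localField (extend E v) x₀ x = v :=
  chartCoord_extend (extChartAt_symm_mem_source hx) v

theorem localField_endo (σ : Π q : M, TangentSpace I q) {x : E}
    (hx : x ∈ (extChartAt I x₀).target) :
    localField (fun q ↦ J q (σ q)) x₀ x = localEndo J x₀ x (localField σ x₀ x) := by
  rw [localEndo_apply, localField, localField,
    chartFrame_chartCoord (extChartAt_symm_mem_source hx)]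

theorem localBilin_localField (σ τ : Π q : M, TangentSpace I q) {x : E}
    (hx : x ∈ (extChartAt I x₀).target) :
    localBilin g x₀ x (localField σ x₀ x) (localField τ x₀ x) =
      g ((extChartAt I x₀).symm x) (σ _) (τ _) := by
  have hq := extChartAt_symm_mem_source hx
  rw [localBilin_apply, localField, localField, chartFrame_chartCoord hq,
    chartFrame_chartCoord hq]

theorem EndoField.IsSmooth.mdiffAt (hJ : J.IsSmooth) {σ : Π q : M, TangentSpace I q}
    (hσ : MDiffAt (T% σ) q) : MDiffAt (T% (fun q ↦ J q (σ q))) q :=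
  MDifferentiableAt.clm_bundle_apply (b := fun x : M ↦ x)
    ((hJ q).mdifferentiableAt (by simp)) hσ

theorem EndoField.isSmooth_of_contDiffAt
    (h : ∀ x₀ : M, ContDiffAt ℝ ∞ (localEndo J x₀) (extChartAt I x₀ x₀)) : J.IsSmooth :=
  fun x₀ ↦ (contMDiffAt_hom_bundle _).2 ⟨contMDiffAt_id,
    contMDiffAt_of_comp_extChartAt_symm (mem_chart_source H x₀) (h x₀)⟩

variable [I.Boundaryless]

theorem BilinField.isSmooth_of_contDiffAt
    (h : ∀ x₀ : M, ContDiffAt ℝ ∞ (localBilin g x₀) (extChartAt I x₀ x₀)) : g.IsSmooth := by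
  intro x₀
  refine (contMDiffAt_hom_bundle _).2 ⟨contMDiffAt_id,
    contMDiffAt_of_comp_extChartAt_symm (mem_chart_source H x₀)
      ((h x₀).congr_of_eventuallyEq ?_)⟩
  filter_upwards [extChartAt_target_mem_nhds_of_mem
    (extChartAt_mem_target (mem_chart_source H x₀))] with x hx
  have hq := extChartAt_symm_mem_source hx
  have hsymm (c : E) : (trivializationAt E (TangentSpace I) x₀).symm ((extChartAt I x₀).symm x) c =
      chartFrame I x₀ ((extChartAt I x₀).symm x) c :=
    ((trivializationAt E (TangentSpace I) x₀).symmₗ_apply (R := ℝ) hq c).symm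
  ext a b
  refine (inCoordinates_apply_eq₂ (E₃ := Bundle.Trivial M ℝ) hq hq (Set.mem_univ _)).trans ?_
  rw [hsymm, hsymm]
  simp [localBilin_apply]

theorem mdifferentiableAt_iff_localField {σ : Π q : M, TangentSpace I q}
    (hq : q ∈ (chartAt H x₀).source) :
    MDiffAt (T% σ) q ↔ DifferentiableAt ℝ (localField σ x₀) (extChartAt I x₀ q) := by
  have hsnd : (fun x : E ↦ (trivializationAt E (TangentSpace I) x₀
      (⟨(extChartAt I x₀).symm x, σ ((extChartAt I x₀).symm x)⟩ : TangentBundle I M)).2)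
      =ᶠ[𝓝 (extChartAt I x₀ q)] localField σ x₀ := by
    filter_upwards [extChartAt_target_mem_nhds_of_mem (extChartAt_mem_target hq)] with x hx
    exact (chartCoord_eq_snd (extChartAt_symm_mem_source hx) _).symm
  rw [(trivializationAt E (TangentSpace I) x₀).mdifferentiableAt_section_iff I σ
    (show q ∈ (trivializationAt E (TangentSpace I) x₀).baseSet from hq),
    ← hsnd.differentiableAt_iff]
  exact ⟨fun h ↦ differentiableAt_comp_extChartAt_symm hq h,
    fun h ↦ mdifferentiableAt_of_comp_extChartAt_symm hq h⟩

variable [FiniteDimensional ℝ E]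

theorem BilinField.IsSmooth.contDiffOn_localBilin (hg : g.IsSmooth) (x₀ : M) :
    ContDiffOn ℝ ∞ (localBilin g x₀) (extChartAt I x₀).target := by
  refine contDiffOn_clm_apply.2 fun a ↦ contDiffOn_clm_apply.2 fun b ↦ fun x hx ↦ ?_
  have hq := extChartAt_symm_mem_source hx
  have h := ContMDiffAt.clm_bundle_apply₂ (b := fun x : M ↦ x) (F₃ := ℝ)
    (E₃ := Bundle.Trivial M ℝ) (hg ((extChartAt I x₀).symm x)) (contMDiffAt_chartField hq a)
    (contMDiffAt_chartField hq b)
  simp only [contMDiffAt_totalSpace] at h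
  exact (contDiffAt_comp_extChartAt_symm hx h.2).contDiffWithinAt

theorem EndoField.IsSmooth.contDiffOn_localEndo (hJ : J.IsSmooth) (x₀ : M) :
    ContDiffOn ℝ ∞ (localEndo J x₀) (extChartAt I x₀).target := by
  refine contDiffOn_clm_apply.2 fun a ↦ fun x hx ↦ ?_
  have hq := extChartAt_symm_mem_source hx
  have h := ContMDiffAt.clm_bundle_apply (b := fun x : M ↦ x) (hJ ((extChartAt I x₀).symm x))
    (contMDiffAt_chartField hq a)
  rw [(trivializationAt E (TangentSpace I) x₀).contMDiffAt_section_iff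
    (show _ ∈ (trivializationAt E (TangentSpace I) x₀).baseSet from hq)] at h
  refine ((contDiffAt_comp_extChartAt_symm hx h).congr_of_eventuallyEq ?_).contDiffWithinAt
  filter_upwards [extChartAt_target_mem_nhds_of_mem hx] with y hy
  exact chartCoord_eq_snd (extChartAt_symm_mem_source hy) _

theorem EndoField.IsSmooth.contDiffAt_localEndo (hJ : J.IsSmooth) {x : E}
    (hx : x ∈ (extChartAt I x₀).target) : ContDiffAt ℝ ∞ (localEndo J x₀) x :=
  (hJ.contDiffOn_localEndo x₀).contDiffAt (extChartAt_target_mem_nhds_of_mem hx)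

theorem EndoField.IsSmooth.differentiableAt_localEndo (hJ : J.IsSmooth) {x : E}
    (hx : x ∈ (extChartAt I x₀).target) : DifferentiableAt ℝ (localEndo J x₀) x :=
  (hJ.contDiffAt_localEndo hx).differentiableAt (by simp)

namespace IsMetric

theorem isLocalMetric (hg : IsMetric g) (x₀ : M) :
    IsLocalMetric (extChartAt I x₀).target (localBilin g x₀) where
  isOpen := isOpen_extChartAt_target x₀
  contDiffOn := hg.smooth.contDiffOn_localBilin x₀
  symm x _ a b := hg.symm ((extChartAt I x₀).symm x) (chartFrame I x₀ _ a)
    (chartFrame I x₀ _ b)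
  nondegenerate x hx a h := by
    have hq := extChartAt_symm_mem_source hx
    have hzero : chartFrame I x₀ ((extChartAt I x₀).symm x) a = 0 := by
      refine hg.nondegenerate ((extChartAt I x₀).symm x) _ fun w ↦ ?_
      rw [← chartFrame_chartCoord hq w]
      exact h _
    rw [← chartCoord_chartFrame (I := I) hq a, hzero, map_zero]

theorem fderiv_localBilin_localField (hg : IsMetric g) (hq : q ∈ (chartAt H x₀).source)
    {σ τ : Π q : M, TangentSpace I q} (hσ : MDiffAt (T% σ) q) (hτ : MDiffAt (T% τ) q) (a : E) :
    fderiv ℝ (fun x ↦ localBilin g x₀ x (localField σ x₀ x) (localField τ x₀ x))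
        (extChartAt I x₀ q) a =
      localBilin g x₀ (extChartAt I x₀ q)
          (chartCoord I x₀ q (leviCivita g σ q (chartFrame I x₀ q a))) (chartCoord I x₀ q (τ q)) +
        localBilin g x₀ (extChartAt I x₀ q) (chartCoord I x₀ q (σ q))
          (chartCoord I x₀ q (leviCivita g τ q (chartFrame I x₀ q a))) := by
  rw [localBilin_chartCoord hq, localBilin_chartCoord hq,
    ← hg.isLeviCivita_leviCivita.metric hσ hτ, mvfderiv_chartFrame hq (hg.smooth.mdiffAt hσ hτ)]
  refine congr($(Filter.EventuallyEq.fderiv_eq ?_) a)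
  filter_upwards [extChartAt_target_mem_nhds_of_mem (extChartAt_mem_target hq)] with y hy
  exact localBilin_localField σ τ hy

theorem chartCoord_leviCivita_chartField (hg : IsMetric g) (hq : q ∈ (chartAt H x₀).source)
    (a b : E) :
    chartCoord I x₀ q (leviCivita g (chartField I x₀ b) q (chartFrame I x₀ q a)) =
      christoffel (localBilin g x₀) (extChartAt I x₀ q) a b := by
  set G := localBilin g x₀
  set x := extChartAt I x₀ q
  have hx : x ∈ (extChartAt I x₀).target := extChartAt_mem_target hq
  have hG := hg.isLocalMetric x₀
  set Γ : E → E → E :=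
    fun a b ↦ chartCoord I x₀ q (leviCivita g (chartField I x₀ b) q (chartFrame I x₀ q a))
  have hsymm (a b : E) : Γ a b = Γ b a := by
    have h := hg.isLeviCivita_leviCivita.torsionFree (mdifferentiableAt_chartField hq a)
      (mdifferentiableAt_chartField hq b)
    rw [mlieBracket_chartField hq] at h
    exact congrArg (chartCoord I x₀ q) (sub_eq_zero.1 h)
  have hmetric (a b c : E) : fderiv ℝ G x a b c = G x (Γ a b) c + G x (Γ a c) b := by
    have hframe (c : E) : chartCoord I x₀ q (chartField I x₀ c q) = c := chartCoord_chartFrame hq c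
    have h := hg.fderiv_localBilin_localField hq (mdifferentiableAt_chartField hq b)
      (mdifferentiableAt_chartField hq c) a
    rw [hframe, hframe, hG.symm _ hx b] at h
    rw [← h, ← fderiv_clm_apply_const₂ (hG.differentiableAt hx)]
    refine congr($(Filter.EventuallyEq.fderiv_eq ?_) a)
    filter_upwards [extChartAt_target_mem_nhds_of_mem hx] with y hy
    rw [localField_chartField b hy, localField_chartField c hy]
  refine hG.eq_christoffel hx fun c ↦ ?_
  rw [hmetric a b c, hmetric b a c, hmetric c a b, hsymm b a, hsymm c a, hsymm c b]
  ring

theorem chartCoord_leviCivita (hg : IsMetric g) (hq : q ∈ (chartAt H x₀).source)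
    {σ : Π q : M, TangentSpace I q} (hσ : MDiffAt (T% σ) q) (v : TangentSpace I q) :
    chartCoord I x₀ q (leviCivita g σ q v) =
      localCovDeriv (localBilin g x₀) (localField σ x₀) (extChartAt I x₀ q)
        (chartCoord I x₀ q v) := by
  have hx := extChartAt_mem_target (I := I) hq
  have hG := hg.isLocalMetric x₀
  refine hG.ext hx fun c ↦ ?_
  have hframe : chartCoord I x₀ q (chartField I x₀ c q) = c := chartCoord_chartFrame hq c
  have hconst : localField (chartField I x₀ c) x₀ =ᶠ[𝓝 (extChartAt I x₀ q)] fun _ ↦ c := by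
    filter_upwards [extChartAt_target_mem_nhds_of_mem hx] with y hy using localField_chartField c hy
  have hσ' := (mdifferentiableAt_iff_localField hq).1 hσ
  have h := hg.fderiv_localBilin_localField hq hσ (mdifferentiableAt_chartField hq c)
    (chartCoord I x₀ q v)
  rw [hframe, hg.chartCoord_leviCivita_chartField hq, chartFrame_chartCoord hq,
    fderiv_clm_apply₂ (hG.differentiableAt hx) hσ' (hconst.differentiableAt_iff.2 (by simp)),
    hconst.eq_of_nhds, hconst.fderiv_eq, localField_extChartAt σ hq,
    hG.fderiv_apply_eq_christoffel hx, fderiv_fun_const, Pi.zero_apply, zero_apply, map_zero] at h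
  rw [localCovDeriv_apply, localField_extChartAt σ hq, map_add, add_apply]
  linarith

theorem chartCoord_covDerivEndo (hg : IsMetric g) (hJ : J.IsSmooth)
    (hq : q ∈ (chartAt H x₀).source) (v w : TangentSpace I q) :
    chartCoord I x₀ q (covDerivEndo g J q v w) =
      localCovDerivEndo (localBilin g x₀) (localEndo J x₀) (extChartAt I x₀ q)
        (chartCoord I x₀ q v) (chartCoord I x₀ q w) := by
  have hx := extChartAt_mem_target (I := I) hq
  have hw : MDiffAt (T% (extend E w)) q := mdifferentiableAt_extend I E w
  have hendo : localField (fun q ↦ J q (extend E w q)) x₀ =ᶠ[𝓝 (extChartAt I x₀ q)]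
      fun x ↦ localEndo J x₀ x (localField (extend E w) x₀ x) := by
    filter_upwards [extChartAt_target_mem_nhds_of_mem hx] with y hy using localField_endo _ hy
  have hcongr : localCovDeriv (localBilin g x₀) (localField (fun q ↦ J q (extend E w q)) x₀)
      (extChartAt I x₀ q) = localCovDeriv (localBilin g x₀)
        (fun x ↦ localEndo J x₀ x (localField (extend E w) x₀ x)) (extChartAt I x₀ q) := by
    rw [localCovDeriv, localCovDeriv, hendo.fderiv_eq, hendo.eq_of_nhds]
  rw [covDerivEndo, map_sub, ← localEndo_chartCoord (J := J) hq,
    hg.chartCoord_leviCivita hq (hJ.mdiffAt hw), hg.chartCoord_leviCivita hq hw, hcongr,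
    localCovDeriv_endo_apply (hJ.differentiableAt_localEndo hx)
      ((mdifferentiableAt_iff_localField hq).1 hw), add_sub_cancel_right,
    localField_extChartAt _ hq, extend_apply_self]

theorem chartCoord_leviCivita_extend (hg : IsMetric g) (hq : q ∈ (chartAt H x₀).source)
    (v w : TangentSpace I x₀) :
    chartCoord I x₀ q (leviCivita g (extend E w) q (extend E v q)) =
      christoffel (localBilin g x₀) (extChartAt I x₀ q) v w := by
  have hconst : localField (extend E w) x₀ =ᶠ[𝓝 (extChartAt I x₀ q)] fun _ ↦ w := by
    filter_upwards [extChartAt_target_mem_nhds_of_mem (extChartAt_mem_target hq)] with y hy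
    exact localField_extend w hy
  rw [hg.chartCoord_leviCivita hq (mdifferentiableAt_extend_of_mem hq w), localCovDeriv_apply,
    hconst.fderiv_eq, hconst.eq_of_nhds, chartCoord_extend hq]
  exact (add_eq_right (M := E)).2 (congr($(fderiv_const_apply (𝕜 := ℝ) (F := E) w) v))

theorem chartCoord_leviCivita_leviCivita_extend (hg : IsMetric g) (v w z : TangentSpace I x₀) :
    chartCoord I x₀ x₀ (leviCivita g (fun y ↦ leviCivita g (extend E z) y (extend E w y)) x₀ v) =
      fderiv ℝ (christoffel (localBilin g x₀)) (extChartAt I x₀ x₀) v w z +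
        christoffel (localBilin g x₀) (extChartAt I x₀ x₀) v
          (christoffel (localBilin g x₀) (extChartAt I x₀ x₀) w z) := by
  have hq := mem_chart_source H x₀
  have hx := extChartAt_mem_target (I := I) hq
  have hΓ := (hg.isLocalMetric x₀).differentiableAt_christoffel hx
  have hlocal : localField (fun y ↦ leviCivita g (extend E z) y (extend E w y)) x₀
      =ᶠ[𝓝 (extChartAt I x₀ x₀)] fun x ↦ christoffel (localBilin g x₀) x w z := by
    filter_upwards [extChartAt_target_mem_nhds_of_mem hx] with y hy
    rw [localField, hg.chartCoord_leviCivita_extend (extChartAt_symm_mem_source hy),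
      (extChartAt I x₀).right_inv hy]
  have hdiff : DifferentiableAt ℝ (fun x ↦ christoffel (localBilin g x₀) x (w : E) (z : E))
      (extChartAt I x₀ x₀) :=
    (hΓ.clm_apply (differentiableAt_const _)).clm_apply (differentiableAt_const _)
  rw [hg.chartCoord_leviCivita hq ((mdifferentiableAt_iff_localField hq).2
      (hlocal.differentiableAt_iff.2 hdiff)), localCovDeriv_apply, hlocal.fderiv_eq,
    hlocal.eq_of_nhds, chartCoord_self]
  exact congrArg (· + _) (fderiv_clm_apply_const₂ (F₁ := E) (F₂ := E) hΓ v w z)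

theorem curvature_eq_localCurvature (hg : IsMetric g) (v w z : TangentSpace I x₀) :
    curvature g x₀ v w z = localCurvature (localBilin g x₀) (extChartAt I x₀ x₀) v w z := by
  rw [← chartCoord_self x₀ (curvature g x₀ v w z), curvature, mlieBracket_extend, map_zero,
    sub_zero, map_sub, hg.chartCoord_leviCivita_leviCivita_extend,
    hg.chartCoord_leviCivita_leviCivita_extend]
  exact add_sub_add_comm _ _ _ _ |>.trans (add_sub_assoc _ _ _).symm

end IsMetric

end ChartExpressions

section Curvature

variable {E : Type*} [NormedAddCommGroup E] [NormedSpace ℝ E]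

theorem localCurvature_swap (G : E → E →L[ℝ] E →L[ℝ] ℝ) (x a b c : E) :
    localCurvature G x a b c = -localCurvature G x b a c := by
  simp only [localCurvature]
  abel

theorem localCurvature_zero_middle (G : E → E →L[ℝ] E →L[ℝ] ℝ) (x a c : E) :
    localCurvature G x a 0 c = 0 := by
  simp [localCurvature]

theorem localCurvature_zero_right (G : E → E →L[ℝ] E →L[ℝ] ℝ) (x a b : E) :
    localCurvature G x a b 0 = 0 := by
  simp [localCurvature]

theorem localCurvature_neg (G : E → E →L[ℝ] E →L[ℝ] ℝ) (x a b c : E) :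
    localCurvature G x a b (-c) = -localCurvature G x a b c := by
  simp only [localCurvature, map_neg]
  abel

variable {H : Type*} [TopologicalSpace H] {I : ModelWithCorners ℝ E H}
  {M : Type*} [TopologicalSpace M] [ChartedSpace H M] [IsManifold I ∞ M]
  {g : BilinField I M} {J : EndoField I M} {x : M}

theorem localBilin_self (v w : TangentSpace I x) :
    localBilin g x (extChartAt I x x) v w = g x v w := by
  have h := localBilin_chartCoord (g := g) (mem_chart_source H x) v w
  rwa [chartCoord_self, chartCoord_self] at h

theorem localEndo_self (v : TangentSpace I x) : localEndo J x (extChartAt I x x) v = J x v := by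
  have h := localEndo_chartCoord (J := J) (mem_chart_source H x) v
  rwa [chartCoord_self, chartCoord_self] at h

namespace IsMetric

variable [FiniteDimensional ℝ E] [I.Boundaryless]

theorem covDerivEndo_eq_localCovDerivEndo (hg : IsMetric g) (hJ : J.IsSmooth)
    (v w : TangentSpace I x) : covDerivEndo g J x v w =
      localCovDerivEndo (localBilin g x) (localEndo J x) (extChartAt I x x) v w := by
  have h := hg.chartCoord_covDerivEndo hJ (mem_chart_source H x) v w
  rwa [chartCoord_self, chartCoord_self, chartCoord_self] at h

theorem curvature_swap (hg : IsMetric g) (u v w : TangentSpace I x) :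
    curvature g x u v w = -curvature g x v u w := by
  rw [hg.curvature_eq_localCurvature, hg.curvature_eq_localCurvature]
  exact localCurvature_swap (E := E) _ _ _ _ _

theorem curvature_zero_middle (hg : IsMetric g) (u w : TangentSpace I x) :
    curvature g x u 0 w = 0 := by
  rw [hg.curvature_eq_localCurvature]
  exact localCurvature_zero_middle (E := E) _ _ _ _

theorem curvature_zero_right (hg : IsMetric g) (u v : TangentSpace I x) :
    curvature g x u v 0 = 0 := by
  rw [hg.curvature_eq_localCurvature]
  exact localCurvature_zero_right (E := E) _ _ _ _

theorem curvature_neg (hg : IsMetric g) (u v w : TangentSpace I x) :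
    curvature g x u v (-w) = -curvature g x u v w := by
  rw [hg.curvature_eq_localCurvature, hg.curvature_eq_localCurvature]
  exact localCurvature_neg (E := E) _ _ _ _ _

theorem curvature_cyclic_sum (hg : IsMetric g) (u v w : TangentSpace I x) :
    curvature g x u v w + curvature g x v w u + curvature g x w u v = 0 := by
  rw [hg.curvature_eq_localCurvature, hg.curvature_eq_localCurvature,
    hg.curvature_eq_localCurvature]
  exact (hg.isLocalMetric x).localCurvature_cyclic_sum
    (extChartAt_mem_target (mem_chart_source H x)) _ _ _

theorem curvature_skew (hg : IsMetric g) (u v w z : TangentSpace I x) :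
    g x (curvature g x u v w) z = -g x w (curvature g x u v z) := by
  rw [← localBilin_self, ← localBilin_self, hg.curvature_eq_localCurvature,
    hg.curvature_eq_localCurvature]
  exact (hg.isLocalMetric x).localCurvature_skew
    (extChartAt_mem_target (mem_chart_source H x)) _ _ _ _

theorem covDerivEndo_zero_left (hg : IsMetric g) (hJ : J.IsSmooth) (w : TangentSpace I x) :
    covDerivEndo g J x 0 w = 0 := by
  rw [hg.covDerivEndo_eq_localCovDerivEndo hJ]
  exact congr($(map_zero (localCovDerivEndo (localBilin g x) (localEndo J x) (extChartAt I x x))) w)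

theorem covDerivEndo_zero_right (hg : IsMetric g) (hJ : J.IsSmooth) (v : TangentSpace I x) :
    covDerivEndo g J x v 0 = 0 := by
  rw [hg.covDerivEndo_eq_localCovDerivEndo hJ]
  exact map_zero (localCovDerivEndo (localBilin g x) (localEndo J x) (extChartAt I x x) v)

theorem localCovDerivEndo_eq_zero (hg : IsMetric g) (hJ : J.IsSmooth) (hparallel : IsParallel g J)
    {y : E} (hy : y ∈ (extChartAt I x).target) :
    localCovDerivEndo (localBilin g x) (localEndo J x) y = 0 := by
  have hq := extChartAt_symm_mem_source hy
  ext a b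
  have h := hg.chartCoord_covDerivEndo hJ hq (chartFrame I x _ a) (chartFrame I x _ b)
  rw [hparallel, map_zero, chartCoord_chartFrame hq, chartCoord_chartFrame hq,
    (extChartAt I x).right_inv hy] at h
  exact h.symm

theorem curvature_endo_comm (hg : IsMetric g) (hJ : J.IsSmooth) (hparallel : IsParallel g J)
    (u v w : TangentSpace I x) :
    curvature g x u v (J x w) = J x (curvature g x u v w) := by
  have hx := extChartAt_mem_target (I := I) (mem_chart_source H x)
  have hcomm := (hg.isLocalMetric x).localCurvature_endo_comm hx (hJ.contDiffAt_localEndo hx)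
    (fun y hy ↦ hg.localCovDerivEndo_eq_zero hJ hparallel hy) u v w
  rw [hg.curvature_eq_localCurvature, hg.curvature_eq_localCurvature]
  exact (congrArg _ (localEndo_self w).symm).trans (hcomm.trans (localEndo_self _))

end IsMetric

end Curvature

section TangentBundleCharts

variable {E : Type*} [NormedAddCommGroup E] [NormedSpace ℝ E]
  {H : Type*} [TopologicalSpace H] {I : ModelWithCorners ℝ E H}
  {M : Type*} [TopologicalSpace M] [ChartedSpace H M] [IsManifold I ∞ M]

theorem chartCoord_mfderiv {E' : Type*} [NormedAddCommGroup E'] [NormedSpace ℝ E']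
    {H' : Type*} [TopologicalSpace H'] {I' : ModelWithCorners ℝ E' H'}
    {N : Type*} [TopologicalSpace N] [ChartedSpace H' N] {f : N → M} {q : N} {x₀ p : M}
    (hf : MDifferentiableAt I' I f q) (hp : f q = p) (hsource : p ∈ (chartAt H x₀).source)
    (v : TangentSpace I' q) (ξ : TangentSpace I p) (hξ : (mfderiv I' I f q v : E) = (ξ : E)) :
    chartCoord I x₀ p ξ = d% (fun y ↦ extChartAt I x₀ (f y)) q v := by
  subst hp
  have hcomp := mfderiv_comp q (mdifferentiableAt_extChartAt (I := I) hsource) hf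
  have hcoord : chartCoord I x₀ (f q) = mfderiv I 𝓘(ℝ, E) (extChartAt I x₀) (f q) :=
    TangentBundle.continuousLinearMapAt_trivializationAt hsource
  obtain rfl : mfderiv I' I f q v = ξ := hξ
  exact (congrArg (fun L : E →L[ℝ] E ↦ L (mfderiv I' I f q v)) hcoord).trans
    (congrArg (fun L : E' →L[ℝ] E ↦ L v) hcomp).symm

theorem tangent_mem_chart_source {u₀ u : TangentBundle I M}
    (hu : u.1 ∈ (chartAt H u₀.1).source) : u ∈ (chartAt (ModelProd H E) u₀).source :=
  (TangentBundle.mem_chart_source_iff _ _).2 hu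

theorem tangent_extChartAt {u₀ u : TangentBundle I M} (hu : u.1 ∈ (chartAt H u₀.1).source) :
    extChartAt I.tangent u₀ u = (extChartAt I u₀.1 u.1, chartCoord I u₀.1 u.1 u.2) := by
  rw [chartCoord_eq_snd hu]
  exact extChartAt_mk u₀ u₀.1 u.1 u.2 rfl

theorem tangent_extChartAt_target (u₀ : TangentBundle I M) :
    (extChartAt I.tangent u₀).target = (extChartAt I u₀.1).target ×ˢ Set.univ := by
  refine (FiberBundle.extChartAt_target (IB := I) u₀).trans ?_
  congr 1
  refine Set.inter_eq_left.2 fun x hx ↦ ?_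
  have hsource := (extChartAt I u₀.1).map_target hx
  rwa [extChartAt_source] at hsource

theorem tangent_extChartAt_symm (u₀ : TangentBundle I M) {x : E}
    (hx : x ∈ (extChartAt I u₀.1).target) (y : E) :
    ((extChartAt I.tangent u₀).symm (x, y)).1 ∈ (chartAt H u₀.1).source ∧
      x = extChartAt I u₀.1 ((extChartAt I.tangent u₀).symm (x, y)).1 ∧
      y = chartCoord I u₀.1 ((extChartAt I.tangent u₀).symm (x, y)).1
        ((extChartAt I.tangent u₀).symm (x, y)).2 := by
  have hz : (x, y) ∈ (extChartAt I.tangent u₀).target := by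
    rw [tangent_extChartAt_target]
    exact ⟨hx, trivial⟩
  have hu : ((extChartAt I.tangent u₀).symm (x, y)).1 ∈ (chartAt H u₀.1).source :=
    (TangentBundle.mem_chart_source_iff _ _).1 (extChartAt_symm_mem_source hz)
  have hcoord := tangent_extChartAt hu
  rw [(extChartAt I.tangent u₀).right_inv hz, Prod.ext_iff] at hcoord
  exact ⟨hu, hcoord⟩

theorem mdifferentiableAt_fiberLine (u : TangentBundle I M) (w : TangentSpace I u.1) :
    MDifferentiableAt 𝓘(ℝ, ℝ) I.tangent
      (fun t : ℝ ↦ (⟨u.1, u.2 + t • w⟩ : TangentBundle I M)) 0 := by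
  have hline : (fun t : ℝ ↦ (trivializationAt E (TangentSpace I) u.1
      (⟨u.1, u.2 + t • w⟩ : TangentBundle I M)).2) = fun t ↦ (u.2 : E) + t • (w : E) :=
    funext fun t ↦ trivializationAt_snd _ _
  refine (mdifferentiableAt_totalSpace (IB := I) _).2 ⟨mdifferentiableAt_const, ?_⟩
  rw [hline]
  exact (hasDerivAt_line (F := E) u.2 u.2 w).differentiableAt.snd.mdifferentiableAt

theorem chartCoord_verticalLift {u₀ u : TangentBundle I M} (hu : u.1 ∈ (chartAt H u₀.1).source)
    (w : TangentSpace I u.1) :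
    chartCoord I.tangent u₀ u (verticalLift u w) = (0, chartCoord I u₀.1 u.1 w) := by
  rw [chartCoord_mfderiv (x₀ := u₀) (mdifferentiableAt_fiberLine u w) (by simp)
    (tangent_mem_chart_source hu) (1 : ℝ) (verticalLift u w) rfl]
  have hline : (fun t : ℝ ↦ extChartAt I.tangent u₀ (⟨u.1, u.2 + t • w⟩ : TangentBundle I M)) =
      fun t ↦ (extChartAt I u₀.1 u.1, chartCoord I u₀.1 u.1 u.2 + t • chartCoord I u₀.1 u.1 w) := by
    ext1 t
    rw [tangent_extChartAt (u := ⟨u.1, u.2 + t • w⟩) hu, map_add, map_smul]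
  rw [hline]
  exact (congrArg (fun L : ℝ →L[ℝ] E × E ↦ L 1) mfderiv_eq_fderiv).trans
    (hasDerivAt_line _ _ _).deriv

section Boundaryless

variable [I.Boundaryless]

theorem chartCoord_mfderiv_section {σ : Π q : M, TangentSpace I q} {u₀ u : TangentBundle I M}
    (hu : u.1 ∈ (chartAt H u₀.1).source) (hσ : MDiffAt (T% σ) u.1) (hσu : σ u.1 = u.2)
    (v : TangentSpace I u.1) (ξ : TangentSpace I.tangent u)
    (hξ : (mfderiv I I.tangent (T% σ) u.1 v : E × E) = (ξ : E × E)) :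
    chartCoord I.tangent u₀ u ξ = (chartCoord I u₀.1 u.1 v,
      fderiv ℝ (localField σ u₀.1) (extChartAt I u₀.1 u.1) (chartCoord I u₀.1 u.1 v)) := by
  have hsection : (T% σ) u.1 = u := congrArg (TotalSpace.mk u.1) hσu
  have hchart : MDifferentiableAt I 𝓘(ℝ, E × E) (fun q ↦ extChartAt I.tangent u₀ ((T% σ) q)) u.1 :=
    MDifferentiableAt.comp u.1
      (mdifferentiableAt_extChartAt (tangent_mem_chart_source (u := (T% σ) u.1) hu)) hσ
  have hlocal : (fun x ↦ extChartAt I.tangent u₀ ((T% σ) ((extChartAt I u₀.1).symm x)))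
      =ᶠ[𝓝 (extChartAt I u₀.1 u.1)] fun x ↦ (x, localField σ u₀.1 x) := by
    filter_upwards [extChartAt_target_mem_nhds_of_mem (extChartAt_mem_target hu)] with x hx
    rw [tangent_extChartAt (u := (T% σ) ((extChartAt I u₀.1).symm x))
      (extChartAt_symm_mem_source hx), (extChartAt I u₀.1).right_inv hx]
    rfl
  have hderiv := mvfderiv_chartFrame hu hchart (chartCoord I u₀.1 u.1 v)
  rw [chartFrame_chartCoord hu, hlocal.fderiv_eq] at hderiv
  refine (chartCoord_mfderiv hσ hsection (tangent_mem_chart_source hu) v ξ hξ).trans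
    (hderiv.trans ?_)
  have hdiff := (mdifferentiableAt_iff_localField hu).1 hσ
  exact congrArg (fun L : E →L[ℝ] E × E ↦ L _)
    ((hasFDerivAt_id (𝕜 := ℝ) _).prodMk hdiff.hasFDerivAt).fderiv

namespace IsMetric

variable [FiniteDimensional ℝ E] {g : BilinField I M}

theorem chartCoord_horizontalLift (hg : IsMetric g) {u₀ u : TangentBundle I M}
    (hu : u.1 ∈ (chartAt H u₀.1).source) (v : TangentSpace I u.1) :
    chartCoord I.tangent u₀ u (horizontalLift (leviCivita g) u v) =
      (chartCoord I u₀.1 u.1 v, -christoffel (localBilin g u₀.1) (extChartAt I u₀.1 u.1)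
        (chartCoord I u₀.1 u.1 v) (chartCoord I u₀.1 u.1 u.2)) := by
  have hσ : MDiffAt (T% (extend E u.2)) u.1 := mdifferentiableAt_extend I E u.2
  have hsection := chartCoord_mfderiv_section hu hσ (extend_apply_self (F := E) u.2) v
    (show TangentSpace I.tangent u from mfderiv I I.tangent (T% (extend E u.2)) u.1 v) rfl
  have hcov := hg.chartCoord_leviCivita hu hσ v
  rw [localCovDeriv_apply, localField_extChartAt _ hu, extend_apply_self] at hcov
  refine (map_sub (chartCoord I.tangent u₀ u) _ _).trans ?_
  rw [chartCoord_verticalLift hu, hcov]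
  refine (congrArg (fun z : E × E ↦ z - _) hsection).trans ?_
  simp

theorem chartCoord_liftEquiv (hg : IsMetric g) {u₀ u : TangentBundle I M}
    (hu : u.1 ∈ (chartAt H u₀.1).source) (v w : TangentSpace I u.1) :
    chartCoord I.tangent u₀ u (liftEquiv (leviCivita g) u (v, w)) =
      (chartCoord I u₀.1 u.1 v, chartCoord I u₀.1 u.1 w -
        christoffel (localBilin g u₀.1) (extChartAt I u₀.1 u.1)
          (chartCoord I u₀.1 u.1 v) (chartCoord I u₀.1 u.1 u.2)) := by
  rw [liftEquiv_apply, map_add, hg.chartCoord_horizontalLift hu, chartCoord_verticalLift hu]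
  simp only [Prod.mk_add_mk, add_zero]
  congr 1
  abel

theorem liftEquiv_symm_chartFrame (hg : IsMetric g) {u₀ u : TangentBundle I M}
    (hu : u.1 ∈ (chartAt H u₀.1).source) (α : E × E) :
    (liftEquiv (leviCivita g) u).symm (chartFrame I.tangent u₀ u α) =
      (chartFrame I u₀.1 u.1 α.1, chartFrame I u₀.1 u.1 (α.2 +
        christoffel (localBilin g u₀.1) (extChartAt I u₀.1 u.1) α.1
          (chartCoord I u₀.1 u.1 u.2))) := by
  rw [ContinuousLinearEquiv.symm_apply_eq, ← chartFrame_chartCoord (I := I.tangent)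
    (tangent_mem_chart_source hu) (liftEquiv (leviCivita g) u _),
    hg.chartCoord_liftEquiv hu, chartCoord_chartFrame hu, chartCoord_chartFrame hu,
    add_sub_cancel_right]

theorem localBilin_completeLift (hg : IsMetric g) (u₀ : TangentBundle I M) {x y : E}
    (hx : x ∈ (extChartAt I u₀.1).target) (α β : E × E) :
    localBilin (completeLift g) u₀ (x, y) α β =
      localBilin g u₀.1 x α.1 (β.2 + christoffel (localBilin g u₀.1) x β.1 y) +
        localBilin g u₀.1 x (α.2 + christoffel (localBilin g u₀.1) x α.1 y) β.1 := by
  obtain ⟨hu, hx', hy'⟩ := tangent_extChartAt_symm u₀ hx y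
  rw [localBilin_apply]
  simp only [completeLift, add_apply, ContinuousLinearMap.comp_apply,
    ContinuousLinearMap.precomp_apply, ContinuousLinearEquiv.coe_coe,
    hg.liftEquiv_symm_chartFrame hu, ← hx', ← hy']
  conv_rhs => rw [hx']
  rw [localBilin_extChartAt hu, localBilin_extChartAt hu, ← hx']
  rfl

end IsMetric

end Boundaryless

end TangentBundleCharts

section LocalTangentMetrics

variable {E : Type*} [NormedAddCommGroup E] [NormedSpace ℝ E]

/-- `Ĝ` is the complete lift of the local metric `G`: at `(x, y)` the horizontal part of a vector
`(v, w)` is `v` and the vertical part is `w + Γ_x(v, y)`. -/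
def IsLocalCompleteLift (U : Set E) (G : E → E →L[ℝ] E →L[ℝ] ℝ)
    (Ĝ : E × E → E × E →L[ℝ] E × E →L[ℝ] ℝ) : Prop :=
  ∀ x ∈ U, ∀ y α β, Ĝ (x, y) α β = G x α.1 (β.2 + christoffel G x β.1 y) +
    G x (α.2 + christoffel G x α.1 y) β.1

/-- The isomorphism `(v, w) ↦ v^H + w^V` for the local metric `G`, at the point `z = (x, y)` of the
tangent bundle. -/
def localLift (G : E → E →L[ℝ] E →L[ℝ] ℝ) (z : E × E) : E × E →L[ℝ] E × E :=
  (ContinuousLinearMap.fst ℝ E E).prod (ContinuousLinearMap.snd ℝ E E -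
    (christoffel G z.1).flip z.2 ∘L ContinuousLinearMap.fst ℝ E E)

theorem localLift_apply (G : E → E →L[ℝ] E →L[ℝ] ℝ) (z p : E × E) :
    localLift G z p = (p.1, p.2 - christoffel G z.1 p.1 z.2) := rfl

theorem hasFDerivAt_comp_fst {F : Type*} [NormedAddCommGroup F] [NormedSpace ℝ F] {B : E → F}
    {x : E} (hB : DifferentiableAt ℝ B x) (y : E) : HasFDerivAt (fun z : E × E ↦ B z.1)
      (fderiv ℝ B x ∘L ContinuousLinearMap.fst ℝ E E) (x, y) :=
  HasFDerivAt.comp (x, y) hB.hasFDerivAt hasFDerivAt_fst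

variable [FiniteDimensional ℝ E] {U : Set E} {G : E → E →L[ℝ] E →L[ℝ] ℝ}
  {Ĝ : E × E → E × E →L[ℝ] E × E →L[ℝ] ℝ} {x : E}

theorem IsLocalMetric.differentiableAt_localLift (hG : IsLocalMetric U G) (hx : x ∈ U)
    {a w : E → E} (ha : DifferentiableAt ℝ a x) (hw : DifferentiableAt ℝ w x) (y : E) :
    DifferentiableAt ℝ (fun z ↦ localLift G z (a z.1, w z.1)) (x, y) := by
  have ha' := hasFDerivAt_comp_fst ha y
  have hw' := hasFDerivAt_comp_fst hw y
  have hΓ := hasFDerivAt_comp_fst (hG.differentiableAt_christoffel hx) y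
  exact (ha'.prodMk (hw'.fun_sub ((hΓ.clm_apply ha').clm_apply hasFDerivAt_snd))).differentiableAt

namespace IsLocalCompleteLift

variable (hĜ : IsLocalCompleteLift U G Ĝ) (hG : IsLocalMetric U G)

include hĜ hG

theorem apply_eq (hx : x ∈ U) (y : E) (α β : E × E) :
    Ĝ (x, y) α β = G x α.1 β.2 + G x α.2 β.1 + fderiv ℝ G x y α.1 β.1 := by
  rw [hĜ x hx, hG.fderiv_apply_eq_christoffel hx, hG.christoffel_symm hx β.1,
    hG.christoffel_symm hx α.1]
  simp only [map_add, add_apply]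
  ring

theorem contDiffOn : ContDiffOn ℝ ∞ Ĝ (U ×ˢ Set.univ) := by
  have hmetric : ContDiffOn ℝ ∞ (fun z : E × E ↦ G z.1) (U ×ˢ Set.univ) :=
    hG.contDiffOn.comp contDiffOn_fst fun z hz ↦ hz.1
  have hderiv : ContDiffOn ℝ ∞ (fun z : E × E ↦ fderiv ℝ G z.1) (U ×ˢ Set.univ) :=
    hG.contDiffOn_fderiv.comp contDiffOn_fst fun z hz ↦ hz.1
  refine contDiffOn_clm_apply.2 fun α ↦ contDiffOn_clm_apply.2 fun β ↦ ?_
  refine ContDiffOn.congr ?_ fun z hz ↦ hĜ.apply_eq hG hz.1 z.2 α β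
  exact (((hmetric.clm_apply contDiffOn_const).clm_apply contDiffOn_const).add
    ((hmetric.clm_apply contDiffOn_const).clm_apply contDiffOn_const)).add
    (((hderiv.clm_apply contDiffOn_snd).clm_apply contDiffOn_const).clm_apply contDiffOn_const)

theorem isLocalMetric : IsLocalMetric (U ×ˢ Set.univ) Ĝ where
  isOpen := hG.isOpen.prod isOpen_univ
  contDiffOn := hĜ.contDiffOn hG
  symm := by
    rintro ⟨x, y⟩ ⟨hx, -⟩ α β
    rw [hĜ.apply_eq hG hx, hĜ.apply_eq hG hx, hG.symm x hx α.1, hG.symm x hx α.2,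
      hG.fderiv_symm hx]
    ring
  nondegenerate := by
    rintro ⟨x, y⟩ ⟨hx, -⟩ α hα
    have hfst : α.1 = 0 := hG.nondegenerate x hx _ fun b ↦ by
      simpa [hĜ.apply_eq hG hx] using hα (0, b)
    have hsnd : α.2 = 0 := hG.nondegenerate x hx _ fun b ↦ by
      simpa [hĜ.apply_eq hG hx, hfst] using hα (b, 0)
    exact Prod.ext hfst hsnd

theorem fderiv_apply_eq (hx : x ∈ U) (y : E) (γ α β : E × E) :
    fderiv ℝ Ĝ (x, y) γ α β = fderiv ℝ G x γ.1 α.1 β.2 + fderiv ℝ G x γ.1 α.2 β.1 +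
      fderiv ℝ (fderiv ℝ G) x γ.1 y α.1 β.1 + fderiv ℝ G x γ.2 α.1 β.1 := by
  have hz : ((x, y) : E × E) ∈ U ×ˢ Set.univ := ⟨hx, trivial⟩
  have hmetric := hasFDerivAt_comp_fst (hG.differentiableAt hx) y
  have hderiv := hasFDerivAt_comp_fst (hG.differentiableAt_fderiv hx) y
  have hconst (c : E) := hasFDerivAt_const (𝕜 := ℝ) c (x, y)
  have heq : Set.EqOn (fun z ↦ Ĝ z α β)
      (fun z ↦ G z.1 α.1 β.2 + G z.1 α.2 β.1 + fderiv ℝ G z.1 z.2 α.1 β.1) (U ×ˢ Set.univ) :=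
    fun z hz ↦ hĜ.apply_eq hG hz.1 z.2 α β
  rw [← fderiv_clm_apply_const₂ ((hĜ.isLocalMetric hG).differentiableAt hz),
    (heq.eventuallyEq_of_mem ((hĜ.isLocalMetric hG).isOpen.mem_nhds hz)).fderiv_eq,
    ((((hmetric.clm_apply (hconst _)).clm_apply (hconst _)).fun_add
      ((hmetric.clm_apply (hconst _)).clm_apply (hconst _))).fun_add
      (((hderiv.clm_apply hasFDerivAt_snd).clm_apply (hconst _)).clm_apply (hconst _))).fderiv]
  simp only [ContinuousLinearMap.comp_zero, zero_add, ContinuousLinearMap.flip_add, add_apply,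
    ContinuousLinearMap.flip_apply, ContinuousLinearMap.comp_apply, ContinuousLinearMap.coe_fst',
    ContinuousLinearMap.coe_snd']
  ring

theorem christoffel_eq (hx : x ∈ U) (y : E) (α β : E × E) :
    christoffel Ĝ (x, y) α β = (christoffel G x α.1 β.1, christoffel G x α.1 β.2 +
      christoffel G x α.2 β.1 + fderiv ℝ (christoffel G) x y α.1 β.1) := by
  refine ((hĜ.isLocalMetric hG).eq_christoffel (x := (x, y)) ⟨hx, trivial⟩ fun γ ↦ ?_).symm
  simp only [hĜ.apply_eq hG hx, hĜ.fderiv_apply_eq hG hx, map_add, add_apply]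
  rw [hG.fderiv_fderiv_comm hx α.1, hG.fderiv_fderiv_comm hx β.1, hG.fderiv_fderiv_comm hx γ.1]
  simp only [hG.fderiv_fderiv_apply hx, hG.christoffel_symm hx β.1 α.1,
    hG.christoffel_symm hx γ.1, hG.fderiv_christoffel_symm hx y β.1 α.1,
    hG.fderiv_christoffel_symm hx y γ.1]
  rw [hG.fderiv_symm hx y β.1, hG.symm x hx β.1]
  linarith [hG.two_mul_christoffel hx α.1 β.1 γ.2, hG.two_mul_christoffel hx α.1 β.2 γ.1,
    hG.two_mul_christoffel hx α.2 β.1 γ.1, hG.fderiv_symm hx γ.1 β.2 α.1]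

theorem localCovDeriv_localLift {a w : E → E} (hx : x ∈ U) (ha : DifferentiableAt ℝ a x)
    (hw : DifferentiableAt ℝ w x) (y s t : E) :
    localCovDeriv Ĝ (fun z ↦ localLift G z (a z.1, w z.1)) (x, y) (localLift G (x, y) (s, t)) =
      localLift G (x, y)
        (localCovDeriv G a x s, localCovDeriv G w x s + localCurvature G x y s (a x)) := by
  have ha' := hasFDerivAt_comp_fst ha y
  have hw' := hasFDerivAt_comp_fst hw y
  have hΓ := hasFDerivAt_comp_fst (hG.differentiableAt_christoffel hx) y
  have hderiv := (ha'.prodMk (hw'.fun_sub ((hΓ.clm_apply ha').clm_apply hasFDerivAt_snd))).fderiv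
  rw [localCovDeriv_apply, hĜ.christoffel_eq hG hx]
  simp only [localLift_apply] at hderiv ⊢
  rw [hderiv]
  ext
  · simp [localCovDeriv_apply]
  · simp only [ContinuousLinearMap.flip_add, add_apply, ContinuousLinearMap.prod_apply,
      ContinuousLinearMap.comp_apply, ContinuousLinearMap.coe_fst', sub_apply,
      ContinuousLinearMap.coe_snd', ContinuousLinearMap.flip_apply, Prod.mk_add_mk,
      localCovDeriv_apply, localCurvature, hG.christoffel_symm hx y,
      hG.christoffel_symm hx (a x) (t - _), hG.fderiv_christoffel_symm hx s y, map_add, map_sub]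
    abel

theorem localCovDerivEndo_localLift {P Q R S : E → E →L[ℝ] E} {K : E × E → E × E →L[ℝ] E × E}
    (hP : DifferentiableAt ℝ P x) (hQ : DifferentiableAt ℝ Q x) (hR : DifferentiableAt ℝ R x)
    (hS : DifferentiableAt ℝ S x) (hx : x ∈ U) (y : E) (hK : DifferentiableAt ℝ K (x, y))
    (hblock : ∀ z ∈ U ×ˢ Set.univ, ∀ a w, K z (localLift G z (a, w)) =
      localLift G z (P z.1 a + Q z.1 w, R z.1 a + S z.1 w)) (s t a w : E) :
    localCovDerivEndo Ĝ K (x, y) (localLift G (x, y) (s, t)) (localLift G (x, y) (a, w)) =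
      localLift G (x, y)
        (localCovDerivEndo G P x s a + localCovDerivEndo G Q x s w
          - Q x (localCurvature G x y s a),
        localCovDerivEndo G R x s a + localCovDerivEndo G S x s w
          + localCurvature G x y s (P x a + Q x w) - S x (localCurvature G x y s a)) := by
  have hz : ((x, y) : E × E) ∈ U ×ˢ Set.univ := ⟨hx, trivial⟩
  have hconst (c : E) : DifferentiableAt ℝ (fun _ ↦ c) x := differentiableAt_const c
  have hlift := hG.differentiableAt_localLift hx (hconst a) (hconst w) y
  have hendo {J : E → E →L[ℝ] E} (hJ : DifferentiableAt ℝ J x) (c : E) :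
      DifferentiableAt ℝ (fun x ↦ J x c) x := hJ.clm_apply (hconst c)
  have hKlift : (fun z ↦ K z (localLift G z (a, w))) =ᶠ[𝓝 (x, y)]
      fun z ↦ localLift G z (P z.1 a + Q z.1 w, R z.1 a + S z.1 w) :=
    Filter.mem_of_superset ((hG.isOpen.prod isOpen_univ).mem_nhds hz) fun z hz ↦ hblock z hz a w
  have hleibniz := localCovDeriv_endo_apply (G := Ĝ) hK hlift (localLift G (x, y) (s, t))
  rw [localCovDeriv_congr hKlift, hĜ.localCovDeriv_localLift hG hx (hconst a) (hconst w),
    hblock _ hz, hĜ.localCovDeriv_localLift hG hx (a := fun x ↦ P x a + Q x w)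
      (w := fun x ↦ R x a + S x w) ((hendo hP a).add (hendo hQ w)) ((hendo hR a).add (hendo hS w)),
    localCovDeriv_add (hendo hP a) (hendo hQ w), localCovDeriv_add (hendo hR a) (hendo hS w)]
    at hleibniz
  rw [← sub_eq_iff_eq_add.2 hleibniz, ← map_sub]
  simp only [add_apply, localCovDeriv_endo_apply hP (hconst _),
    localCovDeriv_endo_apply hQ (hconst _), localCovDeriv_endo_apply hR (hconst _),
    localCovDeriv_endo_apply hS (hconst _), map_add, Prod.mk_sub_mk]
  congr 2 <;> abel

end IsLocalCompleteLift

end LocalTangentMetrics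

section CompleteLift

variable {E : Type*} [NormedAddCommGroup E] [NormedSpace ℝ E]
  {H : Type*} [TopologicalSpace H] {I : ModelWithCorners ℝ E H}
  {M : Type*} [TopologicalSpace M] [ChartedSpace H M] [IsManifold I ∞ M]

theorem completeLift_liftEquiv (g : BilinField I M) (u : TangentBundle I M)
    (p q : TangentSpace I u.1 × TangentSpace I u.1) :
    completeLift g u (liftEquiv (leviCivita g) u p) (liftEquiv (leviCivita g) u q) =
      g u.1 p.1 q.2 + g u.1 p.2 q.1 := by
  simp [completeLift]

namespace IsMetric

variable [FiniteDimensional ℝ E] [I.Boundaryless] {g : BilinField I M}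

theorem isLocalCompleteLift (hg : IsMetric g) (u₀ : TangentBundle I M) :
    IsLocalCompleteLift (extChartAt I u₀.1).target (localBilin g u₀.1)
      (localBilin (completeLift g) u₀) :=
  fun _ hx _ α β ↦ hg.localBilin_completeLift u₀ hx α β

theorem isMetric_completeLift (hg : IsMetric g) : IsMetric (completeLift g) where
  smooth := BilinField.isSmooth_of_contDiffAt fun u ↦ by
    refine ((hg.isLocalCompleteLift u).contDiffOn (hg.isLocalMetric u.1)).contDiffAt ?_
    rw [← tangent_extChartAt_target]
    exact extChartAt_target_mem_nhds u
  symm u ξ η := by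
    obtain ⟨p, rfl⟩ := (liftEquiv (leviCivita g) u).surjective ξ
    obtain ⟨q, rfl⟩ := (liftEquiv (leviCivita g) u).surjective η
    rw [completeLift_liftEquiv, completeLift_liftEquiv, hg.symm _ p.1, hg.symm _ p.2, add_comm]
  nondegenerate u ξ h := by
    obtain ⟨p, rfl⟩ := (liftEquiv (leviCivita g) u).surjective ξ
    have hfst : p.1 = 0 := hg.nondegenerate _ _ fun w ↦ by
      simpa using (completeLift_liftEquiv g u p (0, w)).symm.trans (h _)
    have hsnd : p.2 = 0 := hg.nondegenerate _ _ fun w ↦ by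
      simpa using (completeLift_liftEquiv g u p (w, 0)).symm.trans (h _)
    rw [show p = 0 from Prod.ext hfst hsnd, map_zero]

end IsMetric

end CompleteLift

section BlockLifts

variable {E : Type*} [NormedAddCommGroup E] [NormedSpace ℝ E]
  {H : Type*} [TopologicalSpace H] {I : ModelWithCorners ℝ E H}
  {M : Type*} [TopologicalSpace M] [ChartedSpace H M] [IsManifold I ∞ M]

/-- The field of endomorphisms `v^H + w^V ↦ (P v + Q w)^H + (R v + S w)^V` of the tangent bundle,
where the horizontal lifts are those of the Levi-Civita connection of `g`. -/
def blockLift (g : BilinField I M) (P Q R S : EndoField I M) :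
    EndoField I.tangent (TangentBundle I M) :=
  fun u ↦ (liftEquiv (leviCivita g) u).toContinuousLinearMap ∘L
    ((P u.1).coprod (Q u.1)).prod ((R u.1).coprod (S u.1)) ∘L
      (liftEquiv (leviCivita g) u).symm.toContinuousLinearMap

theorem blockLift_liftEquiv (g : BilinField I M) (P Q R S : EndoField I M) (u : TangentBundle I M)
    (v w : TangentSpace I u.1) :
    blockLift g P Q R S u (liftEquiv (leviCivita g) u (v, w)) =
      liftEquiv (leviCivita g) u (P u.1 v + Q u.1 w, R u.1 v + S u.1 w) := by
  simp [blockLift]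

theorem tangentJ₁_eq_blockLift (g : BilinField I M) (J : EndoField I M) :
    tangentJ₁ g J = blockLift g (fun q ↦ -J q) (fun _ ↦ 0) (fun _ ↦ 0) J := by
  ext1 u
  ext1 ξ
  simp [tangentJ₁, blockLift]

theorem tangentJ₂_eq_blockLift (g : BilinField I M) :
    tangentJ₂ g = blockLift g (fun _ ↦ 0) (fun _ ↦ -ContinuousLinearMap.id ℝ _)
      (fun _ ↦ ContinuousLinearMap.id ℝ _) (fun _ ↦ 0) := by
  ext1 u
  ext1 ξ
  simp [tangentJ₂, blockLift]

theorem tangentJ₃_eq_blockLift (g : BilinField I M) (J : EndoField I M) :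
    tangentJ₃ g J = blockLift g (fun _ ↦ 0) J J (fun _ ↦ 0) := by
  ext1 u
  ext1 ξ
  simp [tangentJ₃, blockLift]

theorem covDerivEndo_id (g : BilinField I M) {x : M}
    (v w : TangentSpace I x) :
    covDerivEndo g (fun _ ↦ ContinuousLinearMap.id ℝ _) x v w = 0 :=
  sub_self _

variable {g : BilinField I M} {J : EndoField I M} {x : M}

theorem IsMetric.covDerivEndo_zero [FiniteDimensional ℝ E] (hg : IsMetric g)
    (v w : TangentSpace I x) : covDerivEndo g (fun _ ↦ 0) x v w = 0 := by
  have hzero : leviCivita g 0 x = 0 := hg.isLeviCivita_leviCivita.isCovariantDerivative.zero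
  exact (sub_zero _).trans congr($hzero v)

theorem IsMetric.covDerivEndo_neg [FiniteDimensional ℝ E] (hg : IsMetric g) (hJ : J.IsSmooth)
    (v w : TangentSpace I x) :
    covDerivEndo g (fun q ↦ -J q) x v w = -covDerivEndo g J x v w := by
  have hneg : leviCivita g ((-1 : ℝ) • fun q ↦ J q (extend E w q)) x =
      (-1 : ℝ) • leviCivita g (fun q ↦ J q (extend E w q)) x :=
    hg.isLeviCivita_leviCivita.isCovariantDerivative.smul_const (-1)
      (hJ.mdiffAt (mdifferentiableAt_extend I E w))
  have hfield : (fun q ↦ (-J q) (extend E w q)) = (-1 : ℝ) • fun q ↦ J q (extend E w q) := by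
    ext1 q
    simp
  rw [covDerivEndo, hfield, hneg, covDerivEndo]
  simp only [neg_smul, one_smul, neg_apply, sub_neg_eq_add, neg_sub]
  abel

namespace EndoField

theorem isSmooth_zero : EndoField.IsSmooth (I := I) (M := M) fun _ ↦ 0 := by
  refine isSmooth_of_contDiffAt fun x₀ ↦ ?_
  have hzero : localEndo (I := I) (M := M) (fun _ ↦ 0) x₀ = fun _ ↦ 0 := by
    ext x
    exact map_zero (chartCoord I x₀ ((extChartAt I x₀).symm x))
  rw [hzero]
  exact contDiffAt_const

variable [I.Boundaryless]

theorem isSmooth_id :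
    EndoField.IsSmooth (I := I) (M := M) fun _ ↦ ContinuousLinearMap.id ℝ _ := by
  refine isSmooth_of_contDiffAt fun x₀ ↦ ?_
  refine (contDiffAt_const (c := ContinuousLinearMap.id ℝ E)).congr_of_eventuallyEq ?_
  filter_upwards [extChartAt_target_mem_nhds (I := I) x₀] with x hx
  ext a
  exact chartCoord_chartFrame (extChartAt_symm_mem_source hx) a

variable [FiniteDimensional ℝ E]

theorem IsSmooth.neg (hJ : J.IsSmooth) : EndoField.IsSmooth fun q ↦ -J q := by
  refine isSmooth_of_contDiffAt fun x₀ ↦ ?_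
  have hneg : localEndo (fun q ↦ -J q) x₀ = fun x ↦ -localEndo J x₀ x := by
    ext x a
    exact map_neg (chartCoord I x₀ ((extChartAt I x₀).symm x)) _
  rw [hneg]
  exact (hJ.contDiffAt_localEndo (mem_extChartAt_target x₀)).neg

end EndoField

namespace IsMetric

variable [I.Boundaryless] [FiniteDimensional ℝ E] {P Q R S : EndoField I M}

theorem chartCoord_liftEquiv_eq_localLift (hg : IsMetric g) {u₀ u : TangentBundle I M}
    (hu : u.1 ∈ (chartAt H u₀.1).source) (v w : TangentSpace I u.1) :
    chartCoord I.tangent u₀ u (liftEquiv (leviCivita g) u (v, w)) =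
      localLift (localBilin g u₀.1) (extChartAt I.tangent u₀ u)
        (chartCoord I u₀.1 u.1 v, chartCoord I u₀.1 u.1 w) := by
  rw [hg.chartCoord_liftEquiv hu, tangent_extChartAt hu, localLift_apply]

theorem localEndo_blockLift (hg : IsMetric g) (u₀ : TangentBundle I M) {z : E × E}
    (hz : z ∈ (extChartAt I u₀.1).target ×ˢ Set.univ) (a w : E) :
    localEndo (blockLift g P Q R S) u₀ z (localLift (localBilin g u₀.1) z (a, w)) =
      localLift (localBilin g u₀.1) z
        (localEndo P u₀.1 z.1 a + localEndo Q u₀.1 z.1 w,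
          localEndo R u₀.1 z.1 a + localEndo S u₀.1 z.1 w) := by
  rw [← tangent_extChartAt_target] at hz
  obtain ⟨u, hsource, rfl⟩ : ∃ u, u ∈ (chartAt (ModelProd H E) u₀).source ∧
      extChartAt I.tangent u₀ u = z :=
    ⟨_, extChartAt_symm_mem_source hz, (extChartAt I.tangent u₀).right_inv hz⟩
  have hu : u.1 ∈ (chartAt H u₀.1).source := (TangentBundle.mem_chart_source_iff _ _).1 hsource
  obtain ⟨a, rfl⟩ : ∃ a', chartCoord I u₀.1 u.1 a' = a := ⟨_, chartCoord_chartFrame hu a⟩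
  obtain ⟨w, rfl⟩ : ∃ w', chartCoord I u₀.1 u.1 w' = w := ⟨_, chartCoord_chartFrame hu w⟩
  have hfst : (extChartAt I.tangent u₀ u).1 = extChartAt I u₀.1 u.1 := by
    rw [tangent_extChartAt hu]
  rw [← hg.chartCoord_liftEquiv_eq_localLift hu, localEndo_chartCoord hsource,
    blockLift_liftEquiv, hg.chartCoord_liftEquiv_eq_localLift hu, hfst]
  simp only [map_add, localEndo_chartCoord hu]

theorem isSmooth_blockLift (hg : IsMetric g) (hP : P.IsSmooth) (hQ : Q.IsSmooth)
    (hR : R.IsSmooth) (hS : S.IsSmooth) : (blockLift g P Q R S).IsSmooth := by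
  refine EndoField.isSmooth_of_contDiffAt fun u₀ ↦ ?_
  set U := (extChartAt I u₀.1).target
  set G := localBilin g u₀.1
  have hΓ : ContDiffOn ℝ ∞ (fun z : E × E ↦ christoffel G z.1) (U ×ˢ Set.univ) :=
    (hg.isLocalMetric u₀.1).contDiffOn_christoffel.comp contDiffOn_fst fun z hz ↦ hz.1
  have hendo {K : EndoField I M} (hK : K.IsSmooth) :
      ContDiffOn ℝ ∞ (fun z : E × E ↦ localEndo K u₀.1 z.1) (U ×ˢ Set.univ) :=
    (hK.contDiffOn_localEndo u₀.1).comp contDiffOn_fst fun z hz ↦ hz.1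
  have hblock : ContDiffOn ℝ ∞ (localEndo (blockLift g P Q R S) u₀) (U ×ˢ Set.univ) := by
    refine contDiffOn_clm_apply.2 fun β ↦ ?_
    have hw : ContDiffOn ℝ ∞ (fun z : E × E ↦ β.2 + christoffel G z.1 β.1 z.2)
        (U ×ˢ Set.univ) :=
      contDiffOn_const.add ((hΓ.clm_apply contDiffOn_const).clm_apply contDiffOn_snd)
    have hfst := ((hendo hP).clm_apply (contDiffOn_const (c := β.1))).add ((hendo hQ).clm_apply hw)
    have hsnd := ((hendo hR).clm_apply (contDiffOn_const (c := β.1))).add ((hendo hS).clm_apply hw)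
    refine (hfst.prodMk
      (hsnd.sub ((hΓ.clm_apply hfst).clm_apply contDiffOn_snd))).congr fun z hz ↦ ?_
    have hβ : localLift G z (β.1, β.2 + christoffel G z.1 β.1 z.2) = β := by
      simp [localLift_apply]
    rw [← hβ, hg.localEndo_blockLift u₀ hz, localLift_apply, hβ]
  refine hblock.contDiffAt ?_
  rw [← tangent_extChartAt_target]
  exact extChartAt_target_mem_nhds u₀

theorem covDerivEndo_blockLift (hg : IsMetric g)
    (hP : P.IsSmooth) (hQ : Q.IsSmooth) (hR : R.IsSmooth) (hS : S.IsSmooth)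
    (u : TangentBundle I M) (s t a w : TangentSpace I u.1) :
    covDerivEndo (completeLift g) (blockLift g P Q R S) u (liftEquiv (leviCivita g) u (s, t))
        (liftEquiv (leviCivita g) u (a, w)) =
      liftEquiv (leviCivita g) u
        (covDerivEndo g P u.1 s a + covDerivEndo g Q u.1 s w
          - Q u.1 (curvature g u.1 u.2 s a),
        covDerivEndo g R u.1 s a + covDerivEndo g S u.1 s w
          + curvature g u.1 u.2 s (P u.1 a + Q u.1 w) - S u.1 (curvature g u.1 u.2 s a)) := by
  have hx : extChartAt I u.1 u.1 ∈ (extChartAt I u.1).target := mem_extChartAt_target u.1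
  have hu := mem_chart_source H u.1
  have hcenter : extChartAt I.tangent u u = (extChartAt I u.1 u.1, u.2) := by
    rw [tangent_extChartAt hu]
    exact congrArg _ (chartCoord_self u.1 u.2)
  have hsmooth := hg.isSmooth_blockLift hP hQ hR hS
  have hK := hsmooth.differentiableAt_localEndo (x₀ := u) (mem_extChartAt_target u)
  have hself (K : EndoField I M) : localEndo K u.1 (extChartAt I u.1 u.1) = K u.1 :=
    ContinuousLinearMap.ext localEndo_self
  have hlift (v w : TangentSpace I u.1) : liftEquiv (leviCivita g) u (v, w) =
      localLift (localBilin g u.1) (extChartAt I u.1 u.1, u.2) (v, w) := by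
    have h := hg.chartCoord_liftEquiv_eq_localLift hu v w
    rwa [chartCoord_self, chartCoord_self, chartCoord_self, hcenter] at h
  rw [hg.isMetric_completeLift.covDerivEndo_eq_localCovDerivEndo hsmooth]
  rw [hcenter] at hK ⊢
  rw [hlift, hlift, hlift]
  refine ((hg.isLocalCompleteLift u).localCovDerivEndo_localLift
    (hg.isLocalMetric u.1) (hP.differentiableAt_localEndo hx) (hQ.differentiableAt_localEndo hx)
    (hR.differentiableAt_localEndo hx) (hS.differentiableAt_localEndo hx) hx u.2 hK
    (fun z hz ↦ hg.localEndo_blockLift u hz) s t a w).trans ?_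
  simp only [hg.covDerivEndo_eq_localCovDerivEndo hP, hg.covDerivEndo_eq_localCovDerivEndo hQ,
    hg.covDerivEndo_eq_localCovDerivEndo hR, hg.covDerivEndo_eq_localCovDerivEndo hS,
    hg.curvature_eq_localCurvature, hself]
  rfl

theorem covDerivEndo_blockLift_vertical (hg : IsMetric g)
    (hP : P.IsSmooth) (hQ : Q.IsSmooth) (hR : R.IsSmooth) (hS : S.IsSmooth)
    {u : TangentBundle I M} (t : TangentSpace I u.1) (η : TangentSpace I.tangent u) :
    covDerivEndo (completeLift g) (blockLift g P Q R S) u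
      (liftEquiv (leviCivita g) u (0, t)) η = 0 := by
  obtain ⟨⟨a, w⟩, rfl⟩ := (liftEquiv (leviCivita g) u).surjective η
  rw [hg.covDerivEndo_blockLift hP hQ hR hS]
  simp [hg.covDerivEndo_zero_left, hg.curvature_zero_middle, hP, hQ, hR, hS]

theorem covDerivEndo_blockLift_horizontal_vertical (hg : IsMetric g)
    (hP : P.IsSmooth) (hQ : Q.IsSmooth) (hR : R.IsSmooth) (hS : S.IsSmooth)
    (u : TangentBundle I M) (s t w : TangentSpace I u.1) :
    covDerivEndo (completeLift g) (blockLift g P Q R S) u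
        (liftEquiv (leviCivita g) u (s, t)) (liftEquiv (leviCivita g) u (0, w)) =
      liftEquiv (leviCivita g) u (covDerivEndo g Q u.1 s w,
        covDerivEndo g S u.1 s w + curvature g u.1 u.2 s (Q u.1 w)) := by
  rw [hg.covDerivEndo_blockLift hP hQ hR hS]
  simp [hg.covDerivEndo_zero_right, hg.curvature_zero_right, hP, hR]

end IsMetric

end BlockLifts

section Traces

theorem sum_inv_toMatrix_mul {ι K F : Type*} [Fintype ι] [DecidableEq ι] [Field K] [AddCommGroup F]
    [Module K F] {B : LinearMap.BilinForm K F} (hsymm : B.IsSymm) (hB : B.Nondegenerate)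
    (b : Module.Basis ι K F) (A : F →ₗ[K] F) :
    ∑ i, ∑ j, (LinearMap.BilinForm.toMatrix b B)⁻¹ i j * B (A (b i)) (b j) =
      LinearMap.trace K F A := by
  have hdet : IsUnit (LinearMap.BilinForm.toMatrix b B).det :=
    isUnit_iff_ne_zero.2 ((LinearMap.BilinForm.nondegenerate_iff_det_ne_zero b).1 hB)
  calc
    _ = ((LinearMap.BilinForm.toMatrix b B)⁻¹ *
          LinearMap.BilinForm.toMatrix b (B.compRight A)).trace := by
      simp [Matrix.trace, Matrix.mul_apply, LinearMap.BilinForm.toMatrix_apply, hsymm.eq (b _)]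
    _ = (LinearMap.toMatrix b b A).trace := by
      rw [LinearMap.BilinForm.toMatrix_compRight, Matrix.nonsing_inv_mul_cancel_left _ _ hdet]
    _ = LinearMap.trace K F A := (LinearMap.trace_eq_matrix_trace K b A).symm

theorem trace_prod_eq {R F F' : Type*} [CommRing R] [AddCommGroup F] [Module R F]
    [Module.Free R F] [Module.Finite R F] [AddCommGroup F'] [Module R F']
    [Module.Free R F'] [Module.Finite R F']
    {A : F →ₗ[R] F} {B : F × F' →ₗ[R] F × F'} (hsnd : ∀ t, B (0, t) = 0)
    (hfst : ∀ s, (B (s, 0)).1 = A s) : LinearMap.trace R (F × F') B = LinearMap.trace R F A := by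
  have hB : B = (B ∘ₗ LinearMap.inl R F F') ∘ₗ LinearMap.fst R F F' := by
    ext p <;> simp [hsnd]
  have hA : LinearMap.fst R F F' ∘ₗ B ∘ₗ LinearMap.inl R F F' = A := by
    ext s
    simp [hfst]
  rw [hB, LinearMap.trace_comp_comm', hA]

end Traces

section LeeForm

variable {E : Type*} [NormedAddCommGroup E] [NormedSpace ℝ E] [FiniteDimensional ℝ E]
  {H : Type*} [TopologicalSpace H] {I : ModelWithCorners ℝ E H}
  {M : Type*} [TopologicalSpace M] [ChartedSpace H M] [IsManifold I ∞ M]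
  {g : BilinField I M}

theorem leeForm_eq_zero_of_isParallel {J : EndoField I M} (hparallel : IsParallel g J) {x : M}
    (z : TangentSpace I x) : leeForm g J x z = 0 := by
  refine Finset.sum_eq_zero fun i _ ↦ Finset.sum_eq_zero fun j _ ↦ ?_
  rw [structureTensor, hparallel, map_zero, zero_apply, mul_zero]

namespace IsMetric

theorem leeForm_eq_trace (hg : IsMetric g) {J : EndoField I M} {x : M} {z : TangentSpace I x}
    {A : TangentSpace I x →ₗ[ℝ] TangentSpace I x}
    (hA : ∀ v w, g x (A v) w = structureTensor g J x v w z) :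
    leeForm g J x z = LinearMap.trace ℝ (TangentSpace I x) A := by
  let B : LinearMap.BilinForm ℝ (TangentSpace I x) :=
    ContinuousLinearMap.coeLM ℝ ∘ₗ (g x).toLinearMap
  have hsymm : B.IsSymm := ⟨hg.symm x⟩
  have hnondegenerate : B.Nondegenerate :=
    ⟨hg.nondegenerate x, fun w hw ↦ hg.nondegenerate x w fun v ↦ (hg.symm x w v).trans (hw v)⟩
  let b : Module.Basis (Fin (Module.finrank ℝ E)) ℝ (TangentSpace I x) := Module.finBasis ℝ E
  rw [← sum_inv_toMatrix_mul hsymm hnondegenerate b A]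
  have hmatrix : LinearMap.BilinForm.toMatrix b B = Matrix.of fun i j ↦ g x (b i) (b j) := by
    ext i j
    exact LinearMap.BilinForm.toMatrix_apply b B i j
  rw [hmatrix]
  exact Finset.sum_congr rfl fun i _ ↦ Finset.sum_congr rfl fun j _ ↦
    congrArg _ (hA (b i) (b j)).symm

variable [I.Boundaryless]

theorem exists_inner_eq_structureTensor (hg : IsMetric g) {J : EndoField I M} (hJ : J.IsSmooth)
    {x : M} (z : TangentSpace I x) : ∃ A : TangentSpace I x →ₗ[ℝ] TangentSpace I x,
      ∀ v w, g x (A v) w = structureTensor g J x v w z := by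
  obtain ⟨sharp, hsharp⟩ := exists_sharp (F := E) (g x) (hg.nondegenerate x)
  let N : E →L[ℝ] E →L[ℝ] E :=
    localCovDerivEndo (localBilin g x) (localEndo J x) (extChartAt I x x)
  let gE : E →L[ℝ] E →L[ℝ] ℝ := g x
  refine ⟨(sharp ∘L ContinuousLinearMap.compL ℝ E E ℝ (gE.flip z) ∘L N).toLinearMap,
    fun v w ↦ (hsharp _ w).trans ?_⟩
  rw [structureTensor, hg.covDerivEndo_eq_localCovDerivEndo hJ]
  rfl

variable {P Q R S : EndoField I M}

theorem leeForm_blockLift (hg : IsMetric g)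
    (hP : P.IsSmooth) (hQ : Q.IsSmooth) (hR : R.IsSmooth) (hS : S.IsSmooth)
    (u : TangentBundle I M) (hcurv : ∀ s w, curvature g u.1 u.2 s (Q u.1 w) = 0)
    (z z' : TangentSpace I u.1) :
    leeForm (completeLift g) (blockLift g P Q R S) u (liftEquiv (leviCivita g) u (z, z')) =
      leeForm g Q u.1 z' + leeForm g S u.1 z := by
  obtain ⟨AQ, hAQ⟩ := hg.exists_inner_eq_structureTensor hQ z'
  obtain ⟨AS, hAS⟩ := hg.exists_inner_eq_structureTensor hS z
  have hĝ := hg.isMetric_completeLift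
  obtain ⟨A, hA⟩ := hĝ.exists_inner_eq_structureTensor (hg.isSmooth_blockLift hP hQ hR hS)
    (liftEquiv (leviCivita g) u (z, z'))
  have hvertical (t : TangentSpace I u.1) : A (liftEquiv (leviCivita g) u (0, t)) = 0 :=
    hĝ.nondegenerate u _ fun η ↦ by
      rw [hA, structureTensor, hg.covDerivEndo_blockLift_vertical hP hQ hR hS, map_zero, zero_apply]
  have hhorizontal (s : TangentSpace I u.1) (p : TangentSpace I u.1 × TangentSpace I u.1)
      (hp : liftEquiv (leviCivita g) u p = A (liftEquiv (leviCivita g) u (s, 0))) :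
      p.1 = AQ s + AS s := hg.ext fun w ↦ by
    have h := hA (liftEquiv (leviCivita g) u (s, 0)) (liftEquiv (leviCivita g) u (0, w))
    rw [structureTensor, hg.covDerivEndo_blockLift_horizontal_vertical hP hQ hR hS, hcurv,
      add_zero, ← hp, completeLift_liftEquiv, completeLift_liftEquiv, map_zero, add_zero] at h
    rw [h, map_add, add_apply, hAQ, hAS, structureTensor, structureTensor]
  have : Module.Finite ℝ (TangentSpace I u.1) := inferInstanceAs (Module.Finite ℝ E)
  let Λ := (liftEquiv (leviCivita g) u).toLinearEquiv
  rw [hg.leeForm_eq_trace hAQ, hg.leeForm_eq_trace hAS, hĝ.leeForm_eq_trace hA, ← map_add,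
    ← LinearMap.trace_conj' A Λ.symm]
  exact trace_prod_eq (fun t ↦ (congrArg Λ.symm (hvertical t)).trans (map_zero Λ.symm))
    fun s ↦ hhorizontal s _ (Λ.apply_symm_apply _)

end IsMetric

end LeeForm

theorem cyclic_sum_right_of_skew {α : Type*} {T : α → α → α → α → ℝ}
    (hskew : ∀ a b c d, T a b c d = -T b a c d) (hskew' : ∀ a b c d, T a b c d = -T a b d c)
    (hcyclic : ∀ a b c d, T a b c d + T b c a d + T c a b d = 0) (a b c d : α) :
    T a b c d + T a c d b + T a d b c = 0 := by
  linarith [hcyclic a b c d, hcyclic a c d b, hcyclic a d b c, hcyclic b c d a,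
    hskew c a b d, hskew d a c b, hskew b a d c, hskew' a b d c, hskew' a c b d, hskew' a d c b,
    hskew' b c a d, hskew' c d a b, hskew' d b a c]

section KahlerForm

variable {E : Type*} [NormedAddCommGroup E] [NormedSpace ℝ E]
  {H : Type*} [TopologicalSpace H] {I : ModelWithCorners ℝ E H}
  {M : Type*} [TopologicalSpace M] [ChartedSpace H M] [IsManifold I ∞ M]
  {g : BilinField I M} {J : EndoField I M} {x : M}

theorem IsAlmostHermitian.twoForm_skew (hgJ : IsAlmostHermitian g J) (v w : TangentSpace I x) :
    twoForm g J x v w = -twoForm g J x w v :=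
  calc
    g x (J x v) w = g x (J x (J x v)) (J x w) := (hgJ.isometry x _ _).symm
    _ = -g x (J x w) v := by rw [hgJ.sq, map_neg, neg_apply, hgJ.isMetric.symm]

theorem IsAlmostNorden.inner_endo_left (hgJ : IsAlmostNorden g J) (v w : TangentSpace I x) :
    g x (J x v) w = g x v (J x w) := by
  have h := hgJ.antiIsometry x (J x v) w
  rw [hgJ.sq, map_neg, neg_apply] at h
  exact (neg_injective h).symm

variable [FiniteDimensional ℝ E]

theorem IsMetric.mvfderiv_twoForm_extend (hg : IsMetric g) (hJ : J.IsSmooth)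
    (u v w : TangentSpace I x) :
    d% (fun y ↦ twoForm g J y (extend E v y) (extend E w y)) x u =
      structureTensor g J x u v w + twoForm g J x (leviCivita g (extend E v) x u) w
        + twoForm g J x v (leviCivita g (extend E w) x u) := by
  have hv := mdifferentiableAt_extend I E v
  have hw := mdifferentiableAt_extend I E w
  have h := hg.isLeviCivita_leviCivita.metric (hJ.mdiffAt hv) hw u
  rw [extend_apply_self, extend_apply_self] at h
  refine h.trans ?_
  simp only [structureTensor, covDerivEndo, twoForm, map_sub, sub_apply,
    ContinuousLinearMap.comp_apply]
  ring

theorem IsMetric.leviCivita_extend_symm (hg : IsMetric g) (v w : TangentSpace I x) :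
    leviCivita g (extend E v) x w = leviCivita g (extend E w) x v := by
  have h := hg.isLeviCivita_leviCivita.torsionFree (mdifferentiableAt_extend I E v)
    (mdifferentiableAt_extend I E w)
  rw [mlieBracket_extend, extend_apply_self, extend_apply_self] at h
  exact (sub_eq_zero.1 h).symm

theorem IsAlmostHermitian.extDerivTwo_twoForm (hgJ : IsAlmostHermitian g J)
    (u v w : TangentSpace I x) :
    extDerivTwo (twoForm g J) x u v w =
      structureTensor g J x u v w - structureTensor g J x v u w + structureTensor g J x w u v := by
  have hg := hgJ.isMetric
  simp only [extDerivTwo, mlieBracket_extend, hg.mvfderiv_twoForm_extend hgJ.smooth, map_zero,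
    zero_apply]
  rw [hg.leviCivita_extend_symm v u, hg.leviCivita_extend_symm w u, hg.leviCivita_extend_symm w v,
    hgJ.twoForm_skew v]
  ring

end KahlerForm

section LiftedStructures

variable {E : Type*} [NormedAddCommGroup E] [NormedSpace ℝ E] [FiniteDimensional ℝ E]
  {H : Type*} [TopologicalSpace H] {I : ModelWithCorners ℝ E H} [I.Boundaryless]
  {M : Type*} [TopologicalSpace M] [ChartedSpace H M] [IsManifold I ∞ M]
  {g : BilinField I M} {J : EndoField I M}

theorem IsMetric.isAlmostNorden_tangentJ₂ (hg : IsMetric g) :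
    IsAlmostNorden (completeLift g) (tangentJ₂ g) where
  isMetric := hg.isMetric_completeLift
  smooth := tangentJ₂_eq_blockLift g ▸ hg.isSmooth_blockLift EndoField.isSmooth_zero
    EndoField.isSmooth_id.neg EndoField.isSmooth_id EndoField.isSmooth_zero
  sq u ξ := by
    obtain ⟨⟨v, w⟩, rfl⟩ := (liftEquiv (leviCivita g) u).surjective ξ
    simp [tangentJ₂_eq_blockLift, blockLift_liftEquiv, ← map_neg]
  antiIsometry u ξ η := by
    obtain ⟨⟨v, w⟩, rfl⟩ := (liftEquiv (leviCivita g) u).surjective ξ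
    obtain ⟨⟨a, b⟩, rfl⟩ := (liftEquiv (leviCivita g) u).surjective η
    simp [tangentJ₂_eq_blockLift, blockLift_liftEquiv, completeLift_liftEquiv]

theorem IsMetric.isParallel_tangentJ₂ (hg : IsMetric g) (hflat : IsFlat g) :
    IsParallel (completeLift g) (tangentJ₂ g) := by
  intro u ξ η
  obtain ⟨⟨s, t⟩, rfl⟩ := (liftEquiv (leviCivita g) u).surjective ξ
  obtain ⟨⟨a, w⟩, rfl⟩ := (liftEquiv (leviCivita g) u).surjective η
  rw [tangentJ₂_eq_blockLift, hg.covDerivEndo_blockLift EndoField.isSmooth_zero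
    EndoField.isSmooth_id.neg EndoField.isSmooth_id EndoField.isSmooth_zero]
  simp [hflat _, hg.covDerivEndo_zero, hg.covDerivEndo_neg EndoField.isSmooth_id, covDerivEndo_id]

namespace IsAlmostNorden

variable (hgJ : IsAlmostNorden g J)
include hgJ

theorem isAlmostHermitian_tangentJ₁ : IsAlmostHermitian (completeLift g) (tangentJ₁ g J) where
  isMetric := hgJ.isMetric.isMetric_completeLift
  smooth := tangentJ₁_eq_blockLift g J ▸ hgJ.isMetric.isSmooth_blockLift hgJ.smooth.neg
    EndoField.isSmooth_zero EndoField.isSmooth_zero hgJ.smooth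
  sq u ξ := by
    obtain ⟨⟨v, w⟩, rfl⟩ := (liftEquiv (leviCivita g) u).surjective ξ
    simp [tangentJ₁_eq_blockLift, blockLift_liftEquiv, hgJ.sq, ← map_neg]
  isometry u ξ η := by
    obtain ⟨⟨v, w⟩, rfl⟩ := (liftEquiv (leviCivita g) u).surjective ξ
    obtain ⟨⟨a, b⟩, rfl⟩ := (liftEquiv (leviCivita g) u).surjective η
    simp [tangentJ₁_eq_blockLift, blockLift_liftEquiv, completeLift_liftEquiv, hgJ.antiIsometry]

theorem isAlmostNorden_tangentJ₃ : IsAlmostNorden (completeLift g) (tangentJ₃ g J) where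
  isMetric := hgJ.isMetric.isMetric_completeLift
  smooth := tangentJ₃_eq_blockLift g J ▸ hgJ.isMetric.isSmooth_blockLift EndoField.isSmooth_zero
    hgJ.smooth hgJ.smooth EndoField.isSmooth_zero
  sq u ξ := by
    obtain ⟨⟨v, w⟩, rfl⟩ := (liftEquiv (leviCivita g) u).surjective ξ
    simp [tangentJ₃_eq_blockLift, blockLift_liftEquiv, hgJ.sq, ← map_neg]
  antiIsometry u ξ η := by
    obtain ⟨⟨v, w⟩, rfl⟩ := (liftEquiv (leviCivita g) u).surjective ξ
    obtain ⟨⟨a, b⟩, rfl⟩ := (liftEquiv (leviCivita g) u).surjective η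
    simp [tangentJ₃_eq_blockLift, blockLift_liftEquiv, completeLift_liftEquiv, hgJ.antiIsometry,
      add_comm]

theorem leeForm_tangentJ₁ (u : TangentBundle I M) (z z' : TangentSpace I u.1) :
    leeForm (completeLift g) (tangentJ₁ g J) u (liftEquiv (leviCivita g) u (z, z')) =
      leeForm g J u.1 z := by
  rw [tangentJ₁_eq_blockLift, hgJ.isMetric.leeForm_blockLift hgJ.smooth.neg EndoField.isSmooth_zero
    EndoField.isSmooth_zero hgJ.smooth u fun s _ ↦ hgJ.isMetric.curvature_zero_right _ s,
    leeForm_eq_zero_of_isParallel fun _ ↦ hgJ.isMetric.covDerivEndo_zero, zero_add]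

theorem leeForm_tangentJ₃ (hflat : IsFlat g) (u : TangentBundle I M) (z z' : TangentSpace I u.1) :
    leeForm (completeLift g) (tangentJ₃ g J) u (liftEquiv (leviCivita g) u (z, z')) =
      leeForm g J u.1 z' := by
  rw [tangentJ₃_eq_blockLift, hgJ.isMetric.leeForm_blockLift EndoField.isSmooth_zero hgJ.smooth
    hgJ.smooth EndoField.isSmooth_zero u fun _ _ ↦ hflat _ _ _ _,
    leeForm_eq_zero_of_isParallel fun _ ↦ hgJ.isMetric.covDerivEndo_zero, add_zero]

end IsAlmostNorden

namespace IsKahlerNorden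

theorem structureTensor_tangentJ₁ (hgJ : IsKahlerNorden g J)
    (u : TangentBundle I M) (s t a w c d : TangentSpace I u.1) :
    structureTensor (completeLift g) (tangentJ₁ g J) u (liftEquiv (leviCivita g) u (s, t))
        (liftEquiv (leviCivita g) u (a, w)) (liftEquiv (leviCivita g) u (c, d)) =
      -2 * g u.1 (J u.1 (curvature g u.1 u.2 s a)) c := by
  obtain ⟨hNorden, hparallel⟩ := hgJ
  have hg := hNorden.isMetric
  have hJ := hNorden.smooth
  rw [structureTensor, tangentJ₁_eq_blockLift, hg.covDerivEndo_blockLift hJ.neg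
    EndoField.isSmooth_zero EndoField.isSmooth_zero hJ, completeLift_liftEquiv]
  simp only [hg.covDerivEndo_neg hJ, hparallel _, hg.covDerivEndo_zero, hg.curvature_neg,
    hg.curvature_endo_comm hJ hparallel, neg_apply, zero_apply, sub_apply, map_sub, map_neg,
    map_zero, neg_zero, add_zero, zero_add, sub_self]
  ring

theorem inner_endo_curvature_skew (hgJ : IsKahlerNorden g J) {x : M}
    (y s a c : TangentSpace I x) :
    g x (J x (curvature g x y s a)) c = -g x (J x (curvature g x y s c)) a := by
  obtain ⟨hNorden, hparallel⟩ := hgJ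
  have hg := hNorden.isMetric
  rw [hNorden.inner_endo_left, hg.curvature_skew,
    hg.curvature_endo_comm hNorden.smooth hparallel, hg.symm]

theorem inner_endo_curvature_cyclic_sum (hgJ : IsKahlerNorden g J) {x : M}
    (y s a c : TangentSpace I x) :
    g x (J x (curvature g x y s a)) c + g x (J x (curvature g x y a c)) s
      + g x (J x (curvature g x y c s)) a = 0 := by
  have hg := hgJ.1.isMetric
  refine cyclic_sum_right_of_skew (T := fun y s a c ↦ g x (J x (curvature g x y s a)) c)
    (fun y s a c ↦ ?_) hgJ.inner_endo_curvature_skew (fun y s a c ↦ ?_) y s a c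
  · simp [hg.curvature_swap y s]
  · rw [← add_apply, ← add_apply, ← map_add, ← map_add, ← map_add, ← map_add,
      hg.curvature_cyclic_sum, map_zero, map_zero, zero_apply]

theorem isAlmostKahler_tangentJ₁ (hgJ : IsKahlerNorden g J) :
    IsAlmostKahler (completeLift g) (tangentJ₁ g J) := by
  refine ⟨hgJ.1.isAlmostHermitian_tangentJ₁, fun u ξ η ζ ↦ ?_⟩
  obtain ⟨⟨s, t⟩, rfl⟩ := (liftEquiv (leviCivita g) u).surjective ξ
  obtain ⟨⟨a, w⟩, rfl⟩ := (liftEquiv (leviCivita g) u).surjective η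
  obtain ⟨⟨c, d⟩, rfl⟩ := (liftEquiv (leviCivita g) u).surjective ζ
  rw [hgJ.1.isAlmostHermitian_tangentJ₁.extDerivTwo_twoForm, hgJ.structureTensor_tangentJ₁,
    hgJ.structureTensor_tangentJ₁, hgJ.structureTensor_tangentJ₁]
  linarith [hgJ.inner_endo_curvature_cyclic_sum u.2 s a c,
    hgJ.inner_endo_curvature_skew u.2 a s c]

end IsKahlerNorden

end LiftedStructures

theorem mainTheorem10_general {E : Type*} [NormedAddCommGroup E] [NormedSpace ℝ E]
    [FiniteDimensional ℝ E] {H : Type*} [TopologicalSpace H] {I : ModelWithCorners ℝ E H}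
    [I.Boundaryless] {M : Type*} [TopologicalSpace M] [ChartedSpace H M] [IsManifold I ∞ M]
    {g : BilinField I M} (hg : IsMetric g) (J : EndoField I M) :
    (IsFlat g → IsKahlerNorden (completeLift g) (tangentJ₂ g)) ∧
    (IsNordenW₂W₃ g J → IsSemiKahler (completeLift g) (tangentJ₁ g J)) ∧
    (IsFlat g → IsNordenW₂W₃ g J → IsNordenW₂W₃ (completeLift g) (tangentJ₃ g J)) ∧
    (IsKahlerNorden g J → IsAlmostKahler (completeLift g) (tangentJ₁ g J)) := by
  refine ⟨fun hflat ↦ ⟨hg.isAlmostNorden_tangentJ₂, hg.isParallel_tangentJ₂ hflat⟩, ?_, ?_,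
    fun hgJ ↦ hgJ.isAlmostKahler_tangentJ₁⟩
  · rintro ⟨hgJ, hlee⟩
    refine ⟨hgJ.isAlmostHermitian_tangentJ₁, fun u ζ ↦ ?_⟩
    obtain ⟨⟨z, z'⟩, rfl⟩ := (liftEquiv (leviCivita g) u).surjective ζ
    rw [hgJ.leeForm_tangentJ₁, hlee]
  · rintro hflat ⟨hgJ, hlee⟩
    refine ⟨hgJ.isAlmostNorden_tangentJ₃, fun u ζ ↦ ?_⟩
    obtain ⟨⟨z, z'⟩, rfl⟩ := (liftEquiv (leviCivita g) u).surjective ζ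
    rw [hgJ.leeForm_tangentJ₃ hflat, hlee]

end

theorem mainTheorem10 {E : Type*} [NormedAddCommGroup E] [NormedSpace ℝ E] [FiniteDimensional ℝ E]
    {M : Type*} [TopologicalSpace M] [ChartedSpace E M] [IsManifold 𝓘(ℝ, E) ∞ M]
    (g : BilinField 𝓘(ℝ, E) M) (J : EndoField 𝓘(ℝ, E) M) (hgJ : IsAlmostNorden g J) :
    (IsFlat g → IsParallel (completeLift g) (tangentJ₂ g)) ∧
    (IsFlat g → IsNordenW₂W₃ g J →
      IsSemiKahler (completeLift g) (tangentJ₁ g J) ∧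
      IsKahlerNorden (completeLift g) (tangentJ₂ g) ∧
      IsNordenW₂W₃ (completeLift g) (tangentJ₃ g J)) ∧
    (IsKahlerNorden g J → IsAlmostKahler (completeLift g) (tangentJ₁ g J)) := by
  obtain ⟨hJ₂, hJ₁, hJ₃, hclosed⟩ := mainTheorem10_general hgJ.isMetric J
  exact ⟨fun hflat ↦ (hJ₂ hflat).2, fun hflat h ↦ ⟨hJ₁ h, hJ₂ hflat, hJ₃ hflat h⟩, hclosed⟩
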